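/- Let $\alpha\ge 0$, $1<p<\infty$, $\beta>0$ and $\mathbb{R}^+=(0,\infty)$. Let $\mathcal{S}_+$ be the Schwartz class on $[0,\infty)$ (restrictions to $[0,\infty)$ of complex-valued Schwartz functions on $\mathbb{R}$). For $f\in\mathcal{S}_+$ and $n=[\alpha]+1$ let $$W_+^{\alpha}f(t)=\frac{(-1)^n}{\Gamma(n-\alpha)}\frac{d^n}{dt^n}\int_t^\infty (s-t)^{n-\alpha-1}f(s)\,ds,\qquad t>0,$$ be its Weyl fractional derivative, and let $\mathcal{T}_p^{(\alpha)}(t^\alpha)$ be the completion of $\mathcal{S}_+$ in the norm $$\|f\|_{\alpha,p}=\frac{1}{\Gamma(\alpha+1)}\Big(\int_0^\infty |W_+^\alpha f(t)|^p\,t^{\alpha p}\,dt\Big)^{1/p}$$ (for $\alpha=0$ this is $L^p(\mathbb{R}^+)$). The inclusion $\mathcal{S}_+\to L^p(\mathbb{R}^+)$ is uniformly continuous for this norm, and elements of $\mathcal{T}_p^{(\alpha)}(t^\alpha)$ are regarded as functions in $L^p(\mathbb{R}^+)$ through its continuous extension. For $r\in\mathbb{R}$ let $T_{r,p}$ be the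 isometry of $\mathcal{T}_p^{(\alpha)}(t^\alpha)$ that extends $T_{r,p}f(s)=e^{-r/p}f(e^{-r}s)$, $f\in\mathcal{S}_+$, by continuity; the same formula holds, for almost every $s>0$, for every $f\in\mathcal{T}_p^{(\alpha)}(t^\alpha)$. Then the generalized Ces\`aro operator $$\mathcal{C}_\beta f(t)=\frac{\beta}{t^\beta}\int_0^t (t-s)^{\beta-1}f(s)\,ds$$ is defined by an absolutely convergent integral for every $f\in\mathcal{T}_p^{(\alpha)}(t^\alpha)$ and almost every $t>0$, it is a bounded linear operator on $\mathcal{T}_p^{(\alpha)}(t^\alpha)$, and its operator norm is $$\|\mathcal{C}_\beta\|=\frac{\Gamma(\beta+1)\,\Gamma(1-1/p)}{\Gamma(\beta+1-1/p)}.$$ Moreover, for every $f\in\mathcal{T}_p^{(\alpha)}(t^\alpha)$, $$\mathcal{C}_\beta f=\beta\int_0^\infty (1-e^{-r})^{\beta-1}e^{-r(1-1/p)}\,T_{r,p}f\,dr ,$$ as a Bochner integral in $\mathcal{T}_p^{(\alpha)}(t^\alpha)$ (the integrand being Bochner integrable), and also pointwise: for every representative of $f$, the integral on the right, evaluated at $t$,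 converges absolutely for almost every $t>0$, and the two sides agree at every $t>0$ (an integral that does not converge absolutely being read as $0$). -/

import Mathlib

open MeasureTheory Set
open scoped ENNReal NNReal SchwartzMap

noncomputable section

namespace CesaroSobolev

/-- Lebesgue measure on `ℝ⁺ = (0, ∞)`. -/
abbrev halfLine : Measure ℝ := volume.restrict (Ioi (0 : ℝ))

/-- The Weyl fractional integral of order `γ > 0`:
`W_+^{-γ} f (t) = Γ(γ)⁻¹ ∫_t^∞ (s - t)^(γ - 1) f(s) ds`. -/
def weylIntegral (γ : ℝ) (f : ℝ → ℂ) (t : ℝ) : ℂ :=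
  (Real.Gamma γ)⁻¹ • ∫ s in Ioi t, (s - t) ^ (γ - 1) • f s

/-- The Weyl fractional derivative of order `α ≥ 0`:
`W_+^α f (t) = (-1)^n (d/dt)^n W_+^{-(n - α)} f (t)` with `n = [α] + 1`. -/
def weylDeriv (α : ℝ) (f : ℝ → ℂ) (t : ℝ) : ℂ :=
  (-1) ^ (⌊α⌋₊ + 1) *
    iteratedDeriv (⌊α⌋₊ + 1) (weylIntegral (((⌊α⌋₊ + 1 : ℕ) : ℝ) - α) f) t

/-- `D_+^α f (t) = Γ(α + 1)⁻¹ t^α W_+^α f (t)`. -/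
def weightedDeriv (α : ℝ) (f : ℝ → ℂ) (t : ℝ) : ℂ :=
  ((Real.Gamma (α + 1))⁻¹ * t ^ α) • weylDeriv α f t

/-! ### Weyl derivatives of Schwartz functions -/

lemma weylIntegral_shift (γ : ℝ) (f : ℝ → ℂ) (t : ℝ) :
    weylIntegral γ f t = (Real.Gamma γ)⁻¹ • ∫ u in Ioi (0 : ℝ), u ^ (γ - 1) • f (u + t) := by
  unfold weylIntegral
  congr 1
  have h := (measurePreserving_add_right (volume : Measure ℝ) t).setIntegral_preimage_emb
    (measurableEmbedding_addRight t) (fun s => (s - t) ^ (γ - 1) • f s) (Ioi t)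
  simpa using h.symm

lemma weight_integrable {γ : ℝ} (h0 : 0 < γ) (h1 : γ ≤ 1) :
    IntegrableOn (fun u : ℝ => u ^ (γ - 1) * ((1 + u) ^ 2)⁻¹) (Ioi 0) := by
  rw [← Ioc_union_Ioi_eq_Ioi (zero_le_one' ℝ), integrableOn_union]
  have hm : Measurable (fun u : ℝ => u ^ (γ - 1) * ((1 + u) ^ 2)⁻¹) := by fun_prop
  constructor
  · have h : IntegrableOn (fun u : ℝ => u ^ (γ - 1)) (Ioc 0 1) := by
      rw [← intervalIntegrable_iff_integrableOn_Ioc_of_le zero_le_one]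
      exact intervalIntegral.intervalIntegrable_rpow' (by linarith)
    refine Integrable.mono' h hm.aestronglyMeasurable ?_
    filter_upwards [ae_restrict_mem measurableSet_Ioc] with u hu
    have hu0 : 0 < u := hu.1
    rw [Real.norm_of_nonneg (by positivity)]
    refine mul_le_of_le_one_right (by positivity) (inv_le_one_of_one_le₀ ?_)
    nlinarith
  · have h : IntegrableOn (fun u : ℝ => u ^ (-2 : ℝ)) (Ioi 1) :=
      integrableOn_Ioi_rpow_of_lt (by norm_num) zero_lt_one
    refine Integrable.mono' h hm.aestronglyMeasurable ?_
    filter_upwards [ae_restrict_mem measurableSet_Ioi] with u hu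
    have hu1 : (1 : ℝ) < u := hu
    have hu0 : 0 < u := by linarith
    rw [Real.norm_of_nonneg (by positivity), Real.rpow_neg hu0.le, Real.rpow_two]
    refine (mul_le_of_le_one_left (by positivity)
      (Real.rpow_le_one_of_one_le_of_nonpos hu1.le (by linarith))).trans ?_
    gcongr
    linarith

lemma schwartz_decay (φ : 𝓢(ℝ, ℂ)) (k : ℕ) :
    ∃ C : ℝ, 0 ≤ C ∧ ∀ x, ‖φ x‖ ≤ C * ((1 + |x|) ^ k)⁻¹ := by
  refine ⟨2 ^ k * (Finset.Iic (k, 0)).sup (fun m => SchwartzMap.seminorm ℂ m.1 m.2) φ,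
    by positivity, fun x => ?_⟩
  have h := SchwartzMap.one_add_le_sup_seminorm_apply (𝕜 := ℂ) (m := (k, 0)) le_rfl le_rfl φ x
  rw [norm_iteratedFDeriv_zero, Real.norm_eq_abs] at h
  rw [← div_eq_mul_inv, le_div_iff₀ (by positivity), mul_comm]
  exact h

lemma weylIntegral_integrand_bound (φ : 𝓢(ℝ, ℂ)) (R : ℝ) (hR : 0 ≤ R) :
    ∃ C : ℝ, ∀ t, |t| ≤ R → ∀ u, 0 < u → ∀ γ : ℝ,
      ‖u ^ (γ - 1) • φ (u + t)‖ ≤ C * (u ^ (γ - 1) * ((1 + u) ^ 2)⁻¹) := by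
  obtain ⟨C, hC, h⟩ := schwartz_decay φ 2
  refine ⟨C * (1 + R) ^ 2, fun t ht u hu γ => ?_⟩
  have h1 : 1 + u ≤ (1 + R) * (1 + |u + t|) := by
    have : u ≤ |u + t| + |t| := by
      have := abs_sub (u + t) t
      rw [add_sub_cancel_right, abs_of_pos hu] at this
      exact this
    nlinarith [abs_nonneg (u + t)]
  have h2 : ((1 + |u + t|) ^ 2)⁻¹ ≤ (1 + R) ^ 2 * ((1 + u) ^ 2)⁻¹ := by
    rw [← div_eq_mul_inv, le_div_iff₀ (by positivity), inv_mul_le_iff₀ (by positivity),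
      mul_comm, ← mul_pow]
    gcongr
  have hpos : 0 ≤ u ^ (γ - 1) := by positivity
  rw [norm_smul, Real.norm_of_nonneg hpos]
  calc u ^ (γ - 1) * ‖φ (u + t)‖
      ≤ u ^ (γ - 1) * (C * ((1 + R) ^ 2 * ((1 + u) ^ 2)⁻¹)) := by
        gcongr
        exact (h _).trans (by gcongr)
    _ = _ := by ring

lemma weylIntegral_integrand_measurable (φ : 𝓢(ℝ, ℂ)) (γ t : ℝ) :
    AEStronglyMeasurable (fun u : ℝ => u ^ (γ - 1) • φ (u + t)) halfLine := by
  have h1 : Measurable (fun u : ℝ => u ^ (γ - 1)) := by fun_prop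
  have h2 : Continuous (fun u : ℝ => φ (u + t)) := φ.continuous.comp (by fun_prop)
  exact (h1.smul h2.measurable).aestronglyMeasurable

lemma weylIntegral_integrand_integrable (φ : 𝓢(ℝ, ℂ)) {γ : ℝ} (h0 : 0 < γ) (h1 : γ ≤ 1) (t : ℝ) :
    IntegrableOn (fun u : ℝ => u ^ (γ - 1) • φ (u + t)) (Ioi 0) := by
  obtain ⟨C, hC⟩ := weylIntegral_integrand_bound φ |t| (abs_nonneg t)
  refine Integrable.mono' ((weight_integrable h0 h1).const_mul C)
    (weylIntegral_integrand_measurable φ γ t) ?_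
  filter_upwards [ae_restrict_mem measurableSet_Ioi] with u hu
  exact hC t le_rfl u hu γ

lemma weylIntegral_hasDerivAt (φ : 𝓢(ℝ, ℂ)) {γ : ℝ} (h0 : 0 < γ) (h1 : γ ≤ 1) (t : ℝ) :
    HasDerivAt (weylIntegral γ φ) (weylIntegral γ (SchwartzMap.derivCLM ℂ ℂ φ) t) t := by
  obtain ⟨C, hC⟩ := weylIntegral_integrand_bound (SchwartzMap.derivCLM ℂ ℂ φ) (|t| + 1)
    (by positivity)
  have key := hasDerivAt_integral_of_dominated_loc_of_deriv_le (μ := halfLine) (𝕜 := ℝ)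
    (F := fun x u => u ^ (γ - 1) • φ (u + x))
    (F' := fun x u => u ^ (γ - 1) • (SchwartzMap.derivCLM ℂ ℂ φ) (u + x))
    (x₀ := t) (s := Metric.ball t 1) (bound := fun u => C * (u ^ (γ - 1) * ((1 + u) ^ 2)⁻¹))
    (Metric.ball_mem_nhds t one_pos)
    (Filter.Eventually.of_forall fun x => weylIntegral_integrand_measurable φ γ x)
    (weylIntegral_integrand_integrable φ h0 h1 t)
    (weylIntegral_integrand_measurable _ γ t)
    (by
      filter_upwards [ae_restrict_mem measurableSet_Ioi] with u hu x hx
      refine hC x ?_ u hu γ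
      rw [Metric.mem_ball, Real.dist_eq] at hx
      have := abs_add_le (x - t) t
      rw [sub_add_cancel] at this
      linarith)
    ((weight_integrable h0 h1).const_mul C)
    (by
      filter_upwards with u x _
      have h : HasDerivAt φ (SchwartzMap.derivCLM ℂ ℂ φ (u + x)) (u + x) := by
        rw [SchwartzMap.derivCLM_apply]
        exact (φ.differentiable (u + x)).hasDerivAt
      have h' := h.comp_const_add u x
      exact h'.const_smul (u ^ (γ - 1)))
  have h3 := key.2.const_smul (Real.Gamma γ)⁻¹
  rw [weylIntegral_shift]
  refine h3.congr_of_eventuallyEq (Filter.Eventually.of_forall fun x => ?_)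
  exact weylIntegral_shift γ φ x

lemma weylIntegral_iteratedDeriv {γ : ℝ} (h0 : 0 < γ) (h1 : γ ≤ 1) (n : ℕ) :
    ∀ φ : 𝓢(ℝ, ℂ), iteratedDeriv n (weylIntegral γ φ) =
      weylIntegral γ ((SchwartzMap.derivCLM ℂ ℂ)^[n] φ) := by
  induction n with
  | zero => intro φ; simp
  | succ n ih =>
    intro φ
    rw [iteratedDeriv_succ', Function.iterate_succ_apply, ← ih]
    congr 1
    funext t
    exact (weylIntegral_hasDerivAt φ h0 h1 t).deriv

lemma weylIntegral_decay (φ : 𝓢(ℝ, ℂ)) {γ : ℝ} (h0 : 0 < γ) (h1 : γ ≤ 1) (k : ℕ) :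
    ∃ C : ℝ, 0 ≤ C ∧ ∀ t, 0 < t → ‖weylIntegral γ φ t‖ ≤ C * ((1 + t) ^ k)⁻¹ := by
  obtain ⟨C, hC, h⟩ := schwartz_decay φ (k + 2)
  have hG := Real.Gamma_pos_of_pos h0
  refine ⟨(Real.Gamma γ)⁻¹ * (C * ∫ u in Ioi (0 : ℝ), u ^ (γ - 1) * ((1 + u) ^ 2)⁻¹), ?_,
    fun t ht => ?_⟩
  · have : 0 ≤ ∫ u in Ioi (0 : ℝ), u ^ (γ - 1) * ((1 + u) ^ 2)⁻¹ :=
      setIntegral_nonneg measurableSet_Ioi fun u hu => by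
        have : 0 < u := hu
        positivity
    positivity
  · rw [weylIntegral_shift, norm_smul, Real.norm_of_nonneg (by positivity), mul_assoc]
    gcongr
    refine (norm_integral_le_of_norm_le
      (((weight_integrable h0 h1).const_mul C).mul_const ((1 + t) ^ k)⁻¹) ?_).trans_eq ?_
    · filter_upwards [ae_restrict_mem measurableSet_Ioi] with u hu
      have hu0 : 0 < u := hu
      have hpos : 0 ≤ u ^ (γ - 1) := by positivity
      rw [norm_smul, Real.norm_of_nonneg hpos]
      have h2 : ((1 + |u + t|) ^ (k + 2))⁻¹ ≤ ((1 + u) ^ 2)⁻¹ * ((1 + t) ^ k)⁻¹ := by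
        rw [← mul_inv, abs_of_pos (by positivity), pow_add, mul_comm]
        gcongr <;> linarith
      calc u ^ (γ - 1) * ‖φ (u + t)‖
          ≤ u ^ (γ - 1) * (C * (((1 + u) ^ 2)⁻¹ * ((1 + t) ^ k)⁻¹)) := by
            gcongr
            exact (h _).trans (by gcongr)
        _ = _ := by ring
    · rw [integral_mul_const, integral_const_mul]

lemma order_pos (α : ℝ≥0) : (0 : ℝ) < ((⌊(α : ℝ)⌋₊ + 1 : ℕ) : ℝ) - α := by
  have := Nat.lt_floor_add_one (α : ℝ)
  push_cast
  linarith

lemma order_le_one (α : ℝ≥0) : ((⌊(α : ℝ)⌋₊ + 1 : ℕ) : ℝ) - α ≤ 1 := by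
  have := Nat.floor_le α.coe_nonneg
  push_cast
  linarith

lemma weylDeriv_schwartz (α : ℝ≥0) (φ : 𝓢(ℝ, ℂ)) :
    weylDeriv α φ = fun t => (-1) ^ (⌊(α : ℝ)⌋₊ + 1) *
      weylIntegral (((⌊(α : ℝ)⌋₊ + 1 : ℕ) : ℝ) - α)
        ((SchwartzMap.derivCLM ℂ ℂ)^[⌊(α : ℝ)⌋₊ + 1] φ) t := by
  funext t
  rw [weylDeriv, weylIntegral_iteratedDeriv (order_pos α) (order_le_one α)]

lemma weylIntegral_add {γ : ℝ} (h0 : 0 < γ) (h1 : γ ≤ 1) (φ ψ : 𝓢(ℝ, ℂ)) (t : ℝ) :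
    weylIntegral γ (φ + ψ : 𝓢(ℝ, ℂ)) t = weylIntegral γ φ t + weylIntegral γ ψ t := by
  simp only [weylIntegral_shift, add_apply, smul_add]
  rw [integral_add (weylIntegral_integrand_integrable φ h0 h1 t)
    (weylIntegral_integrand_integrable ψ h0 h1 t), smul_add]

lemma weylIntegral_smul (γ : ℝ) (c : ℂ) (φ : 𝓢(ℝ, ℂ)) (t : ℝ) :
    weylIntegral γ (c • φ : 𝓢(ℝ, ℂ)) t = c • weylIntegral γ φ t := by
  simp only [weylIntegral_shift, smul_apply, smul_comm _ c, integral_smul]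

lemma weightedDeriv_add (α : ℝ≥0) (φ ψ : 𝓢(ℝ, ℂ)) :
    weightedDeriv α (φ + ψ : 𝓢(ℝ, ℂ)) = weightedDeriv α φ + weightedDeriv α ψ := by
  funext t
  simp only [weightedDeriv, weylDeriv_schwartz, Pi.add_apply]
  rw [iterate_map_add, weylIntegral_add (order_pos α) (order_le_one α), mul_add, smul_add]

lemma weightedDeriv_smul (α : ℝ≥0) (c : ℂ) (φ : 𝓢(ℝ, ℂ)) :
    weightedDeriv α (c • φ : 𝓢(ℝ, ℂ)) = c • weightedDeriv α φ := by
  funext t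
  have h : ∀ n : ℕ, (SchwartzMap.derivCLM ℂ ℂ)^[n] (c • φ) =
      c • (SchwartzMap.derivCLM ℂ ℂ)^[n] φ := by
    intro n
    induction n with
    | zero => rfl
    | succ n ih => rw [Function.iterate_succ_apply', ih, map_smul, Function.iterate_succ_apply']
  simp only [weightedDeriv, weylDeriv_schwartz, Pi.smul_apply]
  rw [h, weylIntegral_smul, mul_smul_comm, smul_comm]

lemma inv_sq_memLp (p : ℝ≥0∞) [Fact (1 ≤ p)] :
    MemLp (fun t : ℝ => ((1 + t) ^ 2)⁻¹) p halfLine := by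
  have hm : Measurable (fun t : ℝ => ((1 + t) ^ 2)⁻¹) := by fun_prop
  have hb : ∀ᵐ t ∂halfLine, ‖((1 + t) ^ 2)⁻¹‖ ≤ 1 := by
    filter_upwards [ae_restrict_mem measurableSet_Ioi] with t ht
    have ht0 : (0 : ℝ) < t := ht
    rw [Real.norm_of_nonneg (by positivity)]
    exact inv_le_one_of_one_le₀ (by nlinarith)
  rcases eq_or_ne p ∞ with rfl | hp
  · exact memLp_top_of_bound hm.aestronglyMeasurable 1 hb
  have hp1 : 1 ≤ p := Fact.out
  have hp0 : p ≠ 0 := (zero_lt_one.trans_le hp1).ne'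
  have hpr : 1 ≤ p.toReal := by
    have := ENNReal.toReal_mono hp hp1
    simpa using this
  rw [← integrable_norm_rpow_iff hm.aestronglyMeasurable hp0 hp]
  have hI : IntegrableOn (fun t : ℝ => ((1 + t) ^ 2)⁻¹) (Ioi 0) := by
    simpa using weight_integrable zero_lt_one le_rfl
  refine Integrable.mono' hI (hm.norm.pow_const _).aestronglyMeasurable ?_
  filter_upwards [hb] with t ht
  have h2 : 0 ≤ ((1 + t) ^ 2)⁻¹ := by positivity
  rw [Real.norm_of_nonneg (by positivity)]
  calc ‖((1 + t) ^ 2)⁻¹‖ ^ p.toReal ≤ ‖((1 + t) ^ 2)⁻¹‖ ^ (1 : ℝ) :=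
        Real.rpow_le_rpow_of_exponent_ge_of_imp (norm_nonneg _) ht hpr (fun _ h => by linarith)
    _ = _ := by rw [Real.rpow_one, Real.norm_of_nonneg h2]

lemma weightedDeriv_memLp (α : ℝ≥0) (p : ℝ≥0∞) [Fact (1 ≤ p)] (φ : 𝓢(ℝ, ℂ)) :
    MemLp (weightedDeriv α φ) p halfLine := by
  set n := ⌊(α : ℝ)⌋₊ + 1 with hn
  set ψ := (SchwartzMap.derivCLM ℂ ℂ)^[n] φ with hψ
  have hγ0 := order_pos α
  have hγ1 := order_le_one α
  obtain ⟨C, hC, h⟩ := weylIntegral_decay ψ hγ0 hγ1 (n + 2)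
  have hG : 0 < Real.Gamma (α + 1) := Real.Gamma_pos_of_pos (by positivity)
  have hcont : Continuous (weylIntegral ((n : ℝ) - α) ψ) :=
    continuous_iff_continuousAt.2 fun t => (weylIntegral_hasDerivAt ψ hγ0 hγ1 t).continuousAt
  have hmeas : Measurable (weightedDeriv α φ) := by
    have h1 : Measurable (fun t : ℝ => (Real.Gamma (α + 1))⁻¹ * t ^ (α : ℝ)) := by fun_prop
    have h2 : Measurable (weylDeriv α φ) := by
      rw [weylDeriv_schwartz]
      exact (hcont.measurable).const_mul _
    exact h1.smul h2
  refine MemLp.of_le_mul (c := (Real.Gamma (α + 1))⁻¹ * C) (inv_sq_memLp p)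
    hmeas.aestronglyMeasurable ?_
  filter_upwards [ae_restrict_mem measurableSet_Ioi] with t ht
  have ht0 : (0 : ℝ) < t := ht
  have hw := h t ht0
  have h3 : t ^ (α : ℝ) ≤ (1 + t) ^ n := by
    calc t ^ (α : ℝ) ≤ (1 + t) ^ (α : ℝ) := Real.rpow_le_rpow ht0.le (by linarith) α.coe_nonneg
      _ ≤ (1 + t) ^ (n : ℝ) := Real.rpow_le_rpow_of_exponent_le (by linarith) (by linarith)
      _ = (1 + t) ^ n := Real.rpow_natCast _ _
  have e1 : ‖weightedDeriv α φ t‖ = (Real.Gamma (α + 1))⁻¹ * t ^ (α : ℝ) *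
      ‖weylIntegral ((n : ℝ) - α) ψ t‖ := by
    rw [weightedDeriv, norm_smul, Real.norm_of_nonneg (by positivity), weylDeriv_schwartz]
    simp only [norm_mul, norm_pow, norm_neg, norm_one, one_pow, one_mul, hψ, hn]
  have e2 : ‖((1 + t) ^ 2)⁻¹‖ = ((1 + t) ^ 2)⁻¹ := Real.norm_of_nonneg (by positivity)
  rw [e1, e2]
  calc (Real.Gamma (α + 1))⁻¹ * t ^ (α : ℝ) * ‖weylIntegral ((n : ℝ) - α) ψ t‖
      ≤ (Real.Gamma (α + 1))⁻¹ * (1 + t) ^ n * (C * ((1 + t) ^ (n + 2))⁻¹) := by gcongr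
    _ = _ := by
      have : (1 + t : ℝ) ≠ 0 := by positivity
      field_simp
      try ring

lemma weylIntegral_contDiff {γ : ℝ} (h0 : 0 < γ) (h1 : γ ≤ 1) (n : ℕ) :
    ∀ φ : 𝓢(ℝ, ℂ), ContDiff ℝ n (weylIntegral γ φ) := by
  induction n with
  | zero =>
    intro φ
    exact contDiff_zero.2
      (continuous_iff_continuousAt.2 fun t => (weylIntegral_hasDerivAt φ h0 h1 t).continuousAt)
  | succ n ih =>
    intro φ
    have hd : deriv (weylIntegral γ φ) = weylIntegral γ (SchwartzMap.derivCLM ℂ ℂ φ) :=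
      funext fun t => (weylIntegral_hasDerivAt φ h0 h1 t).deriv
    push_cast
    refine contDiff_succ_iff_deriv.2
      ⟨fun t => (weylIntegral_hasDerivAt φ h0 h1 t).differentiableAt, by simp, ?_⟩
    rw [hd]
    exact ih _

lemma weylIntegral_scale (γ : ℝ) (f : ℝ → ℂ) {c : ℝ} (hc : 0 < c) (t : ℝ) :
    weylIntegral γ (fun s => f (c * s)) t = c ^ (-γ) • weylIntegral γ f (c * t) := by
  rw [weylIntegral_shift, weylIntegral_shift, smul_comm (c ^ (-γ))]
  congr 1
  have h := integral_comp_mul_left_Ioi (fun u => u ^ (γ - 1) • f (u + c * t)) 0 hc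
  rw [mul_zero] at h
  have h2 : ∫ u in Ioi (0 : ℝ), (c * u) ^ (γ - 1) • f (c * u + c * t) =
      c ^ (γ - 1) • ∫ u in Ioi (0 : ℝ), u ^ (γ - 1) • f (c * (u + t)) := by
    rw [← integral_smul]
    refine setIntegral_congr_fun measurableSet_Ioi fun u hu => ?_
    have hu0 : (0 : ℝ) < u := hu
    simp only [Real.mul_rpow hc.le hu0.le, mul_smul, mul_add]
  have h3 : c ^ (-γ) = (c ^ (γ - 1))⁻¹ * c⁻¹ := by
    rw [← Real.rpow_neg hc.le, ← Real.rpow_neg_one c, ← Real.rpow_add hc]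
    congr 1
    ring
  have h4 : c ^ (γ - 1) ≠ 0 := (Real.rpow_pos_of_pos hc _).ne'
  rw [h3, mul_smul, ← h, h2, smul_smul, inv_mul_cancel₀ h4, one_smul]

lemma weightedDeriv_scale (α : ℝ≥0) (φ ψ : 𝓢(ℝ, ℂ)) {c : ℝ} (hc : 0 < c)
    (h : ∀ s, ψ s = φ (c * s)) {t : ℝ} (ht : 0 < t) :
    weightedDeriv α ψ t = weightedDeriv α φ (c * t) := by
  set n := ⌊(α : ℝ)⌋₊ + 1 with hn
  have hψ : (ψ : ℝ → ℂ) = fun s => φ (c * s) := funext h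
  have h1 : weylIntegral ((n : ℝ) - α) ψ =
      fun t => c ^ (-((n : ℝ) - α)) • weylIntegral ((n : ℝ) - α) φ (c * t) := by
    rw [hψ]
    exact funext fun t => weylIntegral_scale _ _ hc t
  have h2 : iteratedDeriv n (weylIntegral ((n : ℝ) - α) ψ) t =
      c ^ (α : ℝ) • iteratedDeriv n (weylIntegral ((n : ℝ) - α) φ) (c * t) := by
    have h3 := iteratedDeriv_comp_const_smul
      (weylIntegral_contDiff (order_pos α) (order_le_one α) n φ) c
    rw [h1, iteratedDeriv_fun_const_smul_field]
    rw [h3, smul_smul, ← Real.rpow_natCast c n, ← Real.rpow_add hc]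
    congr 2
    ring
  simp only [weightedDeriv, weylDeriv]
  rw [← hn, h2, mul_smul_comm, smul_smul, Real.mul_rpow hc.le ht.le]
  congr 1
  ring

lemma eLpNorm_scale (p : ℝ≥0∞) [Fact (1 ≤ p)] (g : ℝ → ℂ) (hg : MemLp g p halfLine) (r : ℝ) :
    eLpNorm (fun s => Real.exp (-r / p.toReal) • g (Real.exp (-r) * s)) p halfLine =
      eLpNorm g p halfLine := by
  set c := Real.exp (-r) with hc
  have hc0 : 0 < c := Real.exp_pos _
  have hmap : Measure.map (fun s => c * s) halfLine = ENNReal.ofReal c⁻¹ • halfLine := by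
    have h1 := Real.map_volume_mul_left hc0.ne'
    have hpre : (fun s => c * s) ⁻¹' (Ioi (0 : ℝ)) = Ioi 0 := by
      ext s
      simp [hc0]
    have h2 := Measure.restrict_map (μ := volume) (f := fun s : ℝ => c * s) (by fun_prop)
      (measurableSet_Ioi (a := (0 : ℝ)))
    rw [hpre] at h2
    rw [halfLine, ← h2, h1, Measure.restrict_smul, abs_of_pos (inv_pos.2 hc0)]
  have hne : ENNReal.ofReal c⁻¹ ≠ 0 := (ENNReal.ofReal_pos.2 (inv_pos.2 hc0)).ne'
  have hgm : AEStronglyMeasurable g (Measure.map (fun s => c * s) halfLine) := by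
    rw [hmap]
    exact hg.1.smul_measure _
  have h3 := eLpNorm_map_measure (p := p) hgm (by fun_prop)
  rw [hmap, eLpNorm_smul_measure_of_ne_zero hne] at h3
  have h4 : (fun s => Real.exp (-r / p.toReal) • g (c * s)) =
      Real.exp (-r / p.toReal) • (g ∘ fun s => c * s) := rfl
  rw [h4, eLpNorm_const_smul, ← h3, smul_eq_mul, ← mul_assoc]
  have h5 : ‖Real.exp (-r / p.toReal)‖ₑ * ENNReal.ofReal c⁻¹ ^ (1 / p).toReal = 1 := by
    rw [Real.enorm_eq_ofReal (Real.exp_pos _).le, ENNReal.ofReal_rpow_of_pos (inv_pos.2 hc0),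
      ← ENNReal.ofReal_mul (Real.exp_pos _).le, hc, ← Real.exp_neg, ← Real.exp_mul,
      ← Real.exp_add, one_div, ENNReal.toReal_inv]
    rw [show -r / p.toReal + - -r * p.toReal⁻¹ = 0 by ring]
    simp
  rw [h5, one_mul]

/-! ### The Sobolev space -/

/-- The Schwartz class `S_+` on `[0, ∞)`, i.e. the restrictions to `[0, ∞)` of functions in
`𝓢(ℝ, ℂ)`. It is carried here by `𝓢(ℝ, ℂ)` itself, with a seminorm that sees only the restriction
of a function to `(0, ∞)`; functions with equal restrictions become equal in the completion. -/
def SchwartzHalf (_α : ℝ≥0) (_p : ℝ≥0∞) : Type := 𝓢(ℝ, ℂ)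

variable (α : ℝ≥0) (p : ℝ≥0∞)

instance : AddCommGroup (SchwartzHalf α p) := inferInstanceAs (AddCommGroup 𝓢(ℝ, ℂ))

instance : Module ℂ (SchwartzHalf α p) := inferInstanceAs (Module ℂ 𝓢(ℝ, ℂ))

/-- The Schwartz function on `ℝ` that carries an element of `S_+`. -/
def toSchwartz : SchwartzHalf α p ≃ₗ[ℂ] 𝓢(ℝ, ℂ) := LinearEquiv.refl ℂ 𝓢(ℝ, ℂ)

variable [Fact (1 ≤ p)]

/-- `D_+^α` on Schwartz functions, with values in `L^p(ℝ⁺)`. -/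
def schwartzDerivLp : 𝓢(ℝ, ℂ) →ₗ[ℂ] Lp ℂ p halfLine where
  toFun φ := (weightedDeriv_memLp α p φ).toLp (weightedDeriv α φ)
  map_add' φ ψ := by
    rw [← MemLp.toLp_add]
    exact MemLp.toLp_congr _ _ (Filter.EventuallyEq.of_eq (weightedDeriv_add α φ ψ))
  map_smul' c φ := by
    rw [RingHom.id_apply, ← MemLp.toLp_const_smul]
    exact MemLp.toLp_congr _ _ (Filter.EventuallyEq.of_eq (weightedDeriv_smul α c φ))

/-- `D_+^α : S_+ → L^p(ℝ⁺)`. -/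
def derivLp : SchwartzHalf α p →ₗ[ℂ] Lp ℂ p halfLine :=
  schwartzDerivLp α p ∘ₗ (toSchwartz α p).toLinearMap

/-- The norm `‖f‖_{α,p} = ‖D_+^α f‖_p = Γ(α + 1)⁻¹ (∫_0^∞ |W_+^α f(t)|^p t^(α p) dt)^(1/p)`
on `S_+`. -/
instance : SeminormedAddCommGroup (SchwartzHalf α p) :=
  SeminormedAddCommGroup.induced _ _ (derivLp α p)

instance : NormedSpace ℂ (SchwartzHalf α p) :=
  NormedSpace.induced ℂ _ _ (derivLp α p)

/-- The Sobolev space `T_p^{(α)}(t^α)`: the completion of `S_+` in the norm `‖·‖_{α,p}`. -/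
abbrev SobolevT : Type := UniformSpace.Completion (SchwartzHalf α p)

/-- The inclusion of `S_+` into `L^p(ℝ⁺)`. -/
def inclusionLp (φ : SchwartzHalf α p) : Lp ℂ p halfLine :=
  ((SchwartzMap.memLp (toSchwartz α p φ) p volume).restrict (Ioi 0)).toLp (toSchwartz α p φ)

/-- The realization of the elements of `T_p^{(α)}(t^α)` as functions in `L^p(ℝ⁺)`: the continuous
extension of the inclusion of `S_+` into `L^p(ℝ⁺)`. -/
def toLp : SobolevT α p → Lp ℂ p halfLine :=
  UniformSpace.Completion.extension (inclusionLp α p)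

/-! ### The dilation group and the generalized Cesàro operators -/

/-- `T_{r,p} f (s) = e^(-r/p) f(e^(-r) s)` for functions. -/
def dilation (r : ℝ) (f : ℝ → ℂ) (s : ℝ) : ℂ :=
  Real.exp (-r / p.toReal) • f (Real.exp (-r) * s)

/-- The scaling `s ↦ e^{-r} s` of the line. -/
def scaling (r : ℝ) : ℝ ≃L[ℝ] ℝ :=
  ContinuousLinearEquiv.unitsEquivAut ℝ (Units.mk0 (Real.exp (-r)) (Real.exp_pos _).ne')

/-- The composition `φ ↦ φ(e^{-r} ·)` on Schwartz functions. -/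
def compScaling (r : ℝ) : 𝓢(ℝ, ℂ) →ₗ[ℂ] 𝓢(ℝ, ℂ) :=
  (SchwartzMap.compCLMOfContinuousLinearEquiv ℂ (scaling r)).toLinearMap

lemma compScaling_apply (r : ℝ) (φ : 𝓢(ℝ, ℂ)) (s : ℝ) :
    compScaling r φ s = φ (Real.exp (-r) * s) := by
  simp [compScaling, scaling, mul_comm]

/-- `T_{r,p}` on `S_+`. -/
def dilationSchwartz (r : ℝ) : SchwartzHalf α p →ₗ[ℂ] SchwartzHalf α p :=
  (toSchwartz α p).symm.toLinearMap ∘ₗ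
    ((Real.exp (-r / p.toReal) : ℂ) • compScaling r) ∘ₗ (toSchwartz α p).toLinearMap

lemma norm_dilationSchwartz (r : ℝ) (φ : SchwartzHalf α p) :
    ‖dilationSchwartz α p r φ‖ = ‖φ‖ := by
  have h1 : ∀ ψ : SchwartzHalf α p,
      ‖ψ‖ = (eLpNorm (weightedDeriv α (toSchwartz α p ψ)) p halfLine).toReal := fun ψ =>
    Lp.norm_toLp _ (weightedDeriv_memLp α p (toSchwartz α p ψ))
  rw [h1, h1, ← eLpNorm_scale p _ (weightedDeriv_memLp α p (toSchwartz α p φ)) r]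
  congr 1
  refine eLpNorm_congr_ae ?_
  filter_upwards [ae_restrict_mem measurableSet_Ioi] with t ht
  have h2 : toSchwartz α p (dilationSchwartz α p r φ) =
      (Real.exp (-r / p.toReal) : ℂ) • compScaling r (toSchwartz α p φ) := by
    simp [dilationSchwartz]
  rw [h2, weightedDeriv_smul, Pi.smul_apply,
    weightedDeriv_scale α (toSchwartz α p φ) _ (Real.exp_pos (-r))
      (compScaling_apply r (toSchwartz α p φ)) ht]
  rfl

/-- `T_{r,p}` on `T_p^{(α)}(t^α)`: the continuous extension of `T_{r,p}` on `S_+`. -/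
def dilationT (r : ℝ) : SobolevT α p →L[ℂ] SobolevT α p :=
  (LinearIsometry.toContinuousLinearMap
    ⟨dilationSchwartz α p r, norm_dilationSchwartz α p r⟩).completion

/-- The generalized Cesàro operator on functions:
`C_β f (t) = (β / t^β) ∫_0^t (t - s)^(β - 1) f(s) ds`. -/
def cesaro (β : ℝ) (f : ℝ → ℂ) (t : ℝ) : ℂ :=
  (β / t ^ β) • ∫ s in Ioo 0 t, (t - s) ^ (β - 1) • f s

/-- The kernel `(1 - e^(-r))^(β - 1) e^(-r (1 - 1/p))`. -/
def kernel (β : ℝ) (r : ℝ) : ℝ :=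
  (1 - Real.exp (-r)) ^ (β - 1) * Real.exp (-r * (1 - 1 / p.toReal))

end CesaroSobolev

end

noncomputable section

namespace CesaroSobolev

section

/-! ### Dilations on `L^p(ℝ⁺)` -/

/-! Everything is an average of dilations. Substituting `s = t e^{-r}` turns the Cesàro integral
into `β ∫_0^∞ k(r) T_r f dr` with the nonnegative weight `k = kernel p β`. Since `1 - 1/p > 0`, `k`
is integrable with mass `B(β, 1 - 1/p)`. The fractional derivative `D_+^α` extends to an isometry
`derivT` of the Sobolev space into `L^p` that commutes with dilations, so the `T_r` form a strongly
continuous isometry group and the average is a Bochner integral of norm at most `K = β ∫ k`, the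
stated Gamma quotient.

For the reverse inequality (`le_norm_cesaroT`), the group has approximate fixed vectors `F_N = ∫_0^N
T_r φ dr`. The difference `T_h F_N - F_N` is at most `2 h ‖φ‖` in norm, uniformly in `N`, and `∫ r
k(r) dr` is finite, so `C F_N - K F_N` stays bounded. It remains to see that `‖F_N‖` is unbounded.
This is tested in `L^p`: for a bump `φ`, `F_N(t) ≥ t^{-1/p}` on `[e, e^N]`, so `‖F_N‖_p^p ≥ N - 1`.

Both the test in `L^p` and the realization of elements as functions need the embedding to be
bounded. The inversion formula `W_+^{-α} W_+^α φ = φ`, after the substitution `s = t e^{-r}` with `r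
< 0`, writes `φ` as an average of dilations of `D_+^α φ` against an integrable beta kernel
(`eq_integral_dilation_weightedDeriv`). Finally `integral_smul_dilLp_ae_eq` identifies Bochner
integrals in `L^p` with pointwise integrals. -/

lemma quasiMeasurePreserving_const_mul {c : ℝ} (hc : 0 < c) :
    Measure.QuasiMeasurePreserving (fun s : ℝ => c * s) halfLine halfLine := by
  refine ⟨by fun_prop, ?_⟩
  have hpre : (fun s : ℝ => c * s) ⁻¹' (Ioi (0 : ℝ)) = Ioi 0 := by
    ext s
    simp [hc]
  have h := Measure.restrict_map (μ := volume) (f := fun s : ℝ => c * s) (by fun_prop)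
    (measurableSet_Ioi (a := (0 : ℝ)))
  rw [hpre, Real.map_volume_mul_left hc.ne', Measure.restrict_smul] at h
  rw [halfLine, ← h]
  exact Measure.smul_absolutelyContinuous

variable (p : ℝ≥0∞)

lemma dilation_congr_ae (r : ℝ) {f g : ℝ → ℂ} (h : f =ᵐ[halfLine] g) :
    dilation p r f =ᵐ[halfLine] dilation p r g := by
  filter_upwards [(quasiMeasurePreserving_const_mul (Real.exp_pos (-r))).ae h] with t ht
  simp only [dilation, ht]

lemma aestronglyMeasurable_dilation (r : ℝ) {f : ℝ → ℂ} (h : AEStronglyMeasurable f halfLine) :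
    AEStronglyMeasurable (dilation p r f) halfLine :=
  (h.comp_quasiMeasurePreserving
    (quasiMeasurePreserving_const_mul (Real.exp_pos (-r)))).const_smul (Real.exp (-r / p.toReal))

variable [Fact (1 ≤ p)]

lemma eLpNorm_dilation (r : ℝ) {f : ℝ → ℂ} (hf : MemLp f p halfLine) :
    eLpNorm (dilation p r f) p halfLine = eLpNorm f p halfLine :=
  eLpNorm_scale p f hf r

lemma memLp_dilation (r : ℝ) {f : ℝ → ℂ} (hf : MemLp f p halfLine) :
    MemLp (dilation p r f) p halfLine :=
  ⟨aestronglyMeasurable_dilation p r hf.1, by rw [eLpNorm_dilation p r hf]; exact hf.2⟩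

/-- The isometry `T_{r,p}` of `L^p(ℝ⁺)`. -/
def dilLp (r : ℝ) : Lp ℂ p halfLine →ₗᵢ[ℂ] Lp ℂ p halfLine where
  toFun f := (memLp_dilation p r (Lp.memLp f)).toLp (dilation p r f)
  map_add' f g := by
    rw [← MemLp.toLp_add]
    refine MemLp.toLp_congr _ _ ((dilation_congr_ae p r (Lp.coeFn_add f g)).trans ?_)
    exact Filter.Eventually.of_forall fun t => by simp [dilation]
  map_smul' c f := by
    rw [RingHom.id_apply, ← MemLp.toLp_const_smul]
    refine MemLp.toLp_congr _ _ ((dilation_congr_ae p r (Lp.coeFn_smul c f)).trans ?_)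
    exact Filter.Eventually.of_forall fun t => by simp [dilation]; ring
  norm_map' f := by
    simp only [LinearMap.coe_mk, AddHom.coe_mk, Lp.norm_toLp]
    rw [eLpNorm_dilation p r (Lp.memLp f), Lp.norm_def]

lemma dilLp_toLp (r : ℝ) {g : ℝ → ℂ} (hg : MemLp g p halfLine) :
    dilLp p r (hg.toLp g) = (memLp_dilation p r hg).toLp (dilation p r g) :=
  MemLp.toLp_congr (memLp_dilation p r (Lp.memLp _)) _ (dilation_congr_ae p r hg.coeFn_toLp)

lemma coeFn_dilLp (r : ℝ) (f : Lp ℂ p halfLine) :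
    dilLp p r f =ᵐ[halfLine] dilation p r f :=
  (memLp_dilation p r (Lp.memLp f)).coeFn_toLp

/-- Dominated convergence for `|T_r g - T_{r₀} g|^p`: when `|r - r₀| < 1` these functions share a
bounded support in `(0, ∞)` and a common bound. -/
lemma continuous_dilLp_of_hasCompactSupport (hp' : p ≠ ∞) {g : ℝ → ℂ} (hg : MemLp g p halfLine)
    (hc : Continuous g) (hs : HasCompactSupport g) :
    Continuous fun r => dilLp p r (hg.toLp g) := by
  have hp0 : p ≠ 0 := (zero_lt_one.trans_le (Fact.out : 1 ≤ p)).ne'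
  have hp1 : 0 < p.toReal := ENNReal.toReal_pos hp0 hp'
  obtain ⟨M, hM⟩ := hs.exists_bound_of_continuous hc
  have hM0 : 0 ≤ M := (norm_nonneg _).trans (hM 0)
  obtain ⟨R, hR⟩ := hs.isCompact.isBounded.subset_closedBall 0
  have hsupp : ∀ x, R < x → g x = 0 := by
    intro x hx
    by_contra h
    have := hR (subset_tsupport g h)
    rw [mem_closedBall_zero_iff, Real.norm_eq_abs] at this
    linarith [le_abs_self x]
  refine continuous_iff_continuousAt.2 fun r₀ => ?_
  simp only [ContinuousAt, dilLp_toLp]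
  rw [Lp.tendsto_Lp_iff_tendsto_eLpNorm'']
  have hlim : Filter.Tendsto
      (fun r => ∫⁻ t, ‖dilation p r g t - dilation p r₀ g t‖ₑ ^ p.toReal ∂halfLine)
      (nhds r₀) (nhds (∫⁻ _, 0 ∂halfLine)) := by
    refine tendsto_lintegral_filter_of_dominated_convergence
      (fun t => (Iic (Real.exp (r₀ + 1) * R)).indicator
        (fun _ => ENNReal.ofReal (2 * (Real.exp ((|r₀| + 1) / p.toReal) * M)) ^ p.toReal) t)
      ?_ ?_ ?_ ?_
    · refine Filter.Eventually.of_forall fun r => ?_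
      have : ∀ r, Continuous (dilation p r g) := fun r => by
        unfold dilation
        fun_prop
      exact (((this r).sub (this r₀)).measurable.enorm).pow_const _
    · filter_upwards [Metric.ball_mem_nhds r₀ one_pos] with r hr
      rw [Metric.mem_ball, Real.dist_eq] at hr
      filter_upwards [ae_restrict_mem measurableSet_Ioi] with t ht
      have ht0 : (0 : ℝ) < t := ht
      have key : ∀ r, |r - r₀| < 1 →
          ‖dilation p r g t‖ ≤ Real.exp ((|r₀| + 1) / p.toReal) * M := by
        intro r hr
        rw [dilation, norm_smul, Real.norm_of_nonneg (Real.exp_pos _).le]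
        gcongr
        · linarith [neg_abs_le r₀, (abs_lt.1 hr).1]
        · exact hM _
      have key0 : ∀ r, |r - r₀| < 1 → Real.exp (r₀ + 1) * R < t → dilation p r g t = 0 := by
        intro r hr h
        rw [dilation, hsupp, smul_zero]
        -- The radius `R` comes from boundedness of the support alone and may be nonpositive.
        rcases le_or_gt R 0 with hR0 | hR0
        · exact hR0.trans_lt (by positivity)
        · have : Real.exp r * R < t := lt_of_le_of_lt (by
            gcongr
            linarith [(abs_lt.1 hr).2]) h
          rw [Real.exp_neg, lt_inv_mul_iff₀ (Real.exp_pos _)]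
          exact this
      by_cases h : t ≤ Real.exp (r₀ + 1) * R
      · rw [indicator_of_mem (by exact h)]
        gcongr
        rw [← ofReal_norm]
        refine ENNReal.ofReal_le_ofReal ((norm_sub_le _ _).trans ?_)
        linarith [key r hr, key r₀ (by simp)]
      · rw [not_le] at h
        rw [key0 r hr h, key0 r₀ (by simp) h]
        simp [hp1]
    · rw [lintegral_indicator measurableSet_Iic, setLIntegral_const, Measure.restrict_apply
        measurableSet_Iic, inter_comm, Ioi_inter_Iic, Real.volume_Ioc]
      exact (ENNReal.mul_lt_top (ENNReal.rpow_lt_top_of_nonneg hp1.le ENNReal.ofReal_ne_top)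
        ENNReal.ofReal_lt_top).ne
    · refine Filter.Eventually.of_forall fun t => ?_
      have h1 : Continuous fun r => ‖dilation p r g t - dilation p r₀ g t‖ₑ ^ p.toReal := by
        unfold dilation
        refine (ENNReal.continuous_rpow_const).comp (Continuous.enorm ?_)
        fun_prop
      have := h1.tendsto r₀
      simpa [hp1] using this
  rw [lintegral_zero] at hlim
  have h2 := (ENNReal.continuous_rpow_const (y := 1 / p.toReal)).tendsto 0 |>.comp hlim
  rw [ENNReal.zero_rpow_of_pos (by positivity)] at h2
  refine h2.congr fun r => ?_
  rw [eLpNorm_eq_lintegral_rpow_enorm_toReal hp0 hp']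
  rfl

/-- Since the dilations are isometries, approximating `f` by a compactly supported continuous
function approximates its whole orbit uniformly in `r`. The density used here needs `p ≠ ∞`. -/
lemma continuous_dilLp (hp' : p ≠ ∞) (f : Lp ℂ p halfLine) :
    Continuous fun r => dilLp p r f := by
  refine continuous_of_uniform_approx_of_continuous fun u hu => ?_
  obtain ⟨ε, hε, hεu⟩ := Metric.mem_uniformity_dist.1 hu
  obtain ⟨g, hgs, hfg, hgc, hg⟩ := (Lp.memLp f).exists_hasCompactSupport_eLpNorm_sub_le hp'
    (ε := ENNReal.ofReal (ε / 2)) (by simpa using hε)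
  refine ⟨fun r => dilLp p r (hg.toLp g),
    continuous_dilLp_of_hasCompactSupport p hp' hg hgc hgs, fun r => hεu ?_⟩
  rw [(dilLp p r).dist_map]
  have h1 : f = (Lp.memLp f).toLp f := (Lp.toLp_coeFn f _).symm
  rw [h1, dist_eq_norm, ← MemLp.toLp_sub, Lp.norm_toLp]
  have h2 := ENNReal.toReal_mono ENNReal.ofReal_ne_top hfg
  rw [ENNReal.toReal_ofReal (by positivity)] at h2
  linarith

end

section

/-! ### Averages of dilations on `L^p(ℝ⁺)` -/

variable (p : ℝ≥0∞)

lemma aestronglyMeasurable_dilation_prod (ν : Measure ℝ) [SFinite ν] {g : ℝ → ℂ}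
    (hg : AEStronglyMeasurable g halfLine) :
    AEStronglyMeasurable (fun x : ℝ × ℝ => dilation p x.1 g x.2) (ν.prod halfLine) := by
  have h1 : Measure.QuasiMeasurePreserving (fun x : ℝ × ℝ => Real.exp (-x.1) * x.2)
      (ν.prod halfLine) halfLine :=
    QuasiMeasurePreserving.prod_of_right (by fun_prop)
      (Filter.Eventually.of_forall fun r => quasiMeasurePreserving_const_mul (Real.exp_pos (-r)))
  have h2 : Measurable fun x : ℝ × ℝ => Real.exp (-x.1 / p.toReal) := by fun_prop
  exact h2.aestronglyMeasurable.smul (hg.comp_quasiMeasurePreserving h1)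

variable [Fact (1 ≤ p)]

/-- Hölder's inequality against the constant function `1`. -/
lemma integral_norm_le_of_memLp {Ω : Type*} [MeasurableSpace Ω] {μ : Measure Ω}
    [IsFiniteMeasure μ] {f : Ω → ℂ} (hf : MemLp f p μ) :
    ∫ x, ‖f x‖ ∂μ ≤ (eLpNorm f p μ).toReal * (μ univ ^ (1 - 1 / p.toReal)).toReal := by
  have h1 : (1 : ℝ≥0∞) ≤ p := Fact.out
  have h := eLpNorm_le_eLpNorm_mul_rpow_measure_univ h1 hf.1
  rw [integral_norm_eq_lintegral_enorm hf.1, ← eLpNorm_one_eq_lintegral_enorm,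
    ← ENNReal.toReal_mul]
  rw [ENNReal.toReal_one, div_one] at h
  refine ENNReal.toReal_mono (ENNReal.mul_ne_top hf.2.ne ?_) h
  refine ENNReal.rpow_ne_top_of_nonneg ?_ (measure_ne_top _ _)
  rcases eq_or_ne p ∞ with rfl | hp
  · simp
  · have h2 : 1 ≤ p.toReal := by simpa using ENNReal.toReal_mono hp h1
    rw [sub_nonneg, div_le_one (by linarith)]
    exact h2

/-- The hypothesis for Fubini. On a set `A` of finite measure the `L^1` norm of `T_r g` is
controlled by its `L^p` norm, which does not depend on `r`, so integrability in `r` is that of `k`.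
-/
lemma integrable_smul_dilation_prod {ν : Measure ℝ} [SFinite ν] {k : ℝ → ℝ}
    (hk : Integrable k ν) {g : ℝ → ℂ} (hg : MemLp g p halfLine) {A : Set ℝ}
    (hA : halfLine A < ∞) :
    Integrable (fun x : ℝ × ℝ => k x.1 • dilation p x.1 g x.2)
      (ν.prod (halfLine.restrict A)) := by
  have : IsFiniteMeasure (halfLine.restrict A) := ⟨by simpa using hA⟩
  have hm : AEStronglyMeasurable (fun x : ℝ × ℝ => k x.1 • dilation p x.1 g x.2)
      (ν.prod (halfLine.restrict A)) := by
    refine AEStronglyMeasurable.smul hk.1.comp_fst ?_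
    exact (aestronglyMeasurable_dilation_prod p ν hg.1).mono_ac
      (Measure.AbsolutelyContinuous.prod Measure.AbsolutelyContinuous.rfl
        Measure.restrict_le_self.absolutelyContinuous)
  have hL : ∀ r, MemLp (dilation p r g) p (halfLine.restrict A) :=
    fun r => (memLp_dilation p r hg).restrict A
  refine (integrable_prod_iff hm).2 ⟨Filter.Eventually.of_forall fun r =>
    ((hL r).integrable Fact.out).smul (k r), ?_⟩
  refine Integrable.mono' (hk.norm.mul_const ((eLpNorm g p halfLine).toReal *
    (halfLine A ^ (1 - 1 / p.toReal)).toReal)) hm.norm.integral_prod_right' ?_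
  refine Filter.Eventually.of_forall fun r => ?_
  rw [Real.norm_of_nonneg (by positivity)]
  simp only [norm_smul]
  rw [integral_const_mul]
  gcongr
  refine (integral_norm_le_of_memLp p (hL r)).trans ?_
  rw [Measure.restrict_apply_univ]
  gcongr
  · exact hg.2.ne
  · rw [← eLpNorm_dilation p r hg]
    exact eLpNorm_mono_measure _ Measure.restrict_le_self

/-- Fubini gives this on each `(0, n]`, and these sets exhaust the half-line. -/
lemma ae_integrable_smul_dilation {ν : Measure ℝ} [SFinite ν] {k : ℝ → ℝ}
    (hk : Integrable k ν) {g : ℝ → ℂ} (hg : MemLp g p halfLine) :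
    ∀ᵐ t ∂halfLine, Integrable (fun r => k r • dilation p r g t) ν := by
  have h : ∀ n : ℕ, ∀ᵐ t ∂halfLine, t ∈ Iic (n : ℝ) →
      Integrable (fun r => k r • dilation p r g t) ν := by
    intro n
    rw [← ae_restrict_iff' measurableSet_Iic]
    refine (integrable_smul_dilation_prod p hk hg ?_).prod_left_ae
    rw [Measure.restrict_apply measurableSet_Iic, inter_comm, Ioi_inter_Iic, Real.volume_Ioc]
    exact ENNReal.ofReal_lt_top
  filter_upwards [ae_all_iff.2 h] with t ht
  obtain ⟨n, hn⟩ := exists_nat_ge t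
  exact ht n hn

/-- Integration over a set of finite measure, as a functional on `L^p(ℝ⁺)`. -/
def setIntegralLp (A : Set ℝ) (hA : halfLine A < ∞) : Lp ℂ p halfLine →L[ℝ] ℂ :=
  have : IsFiniteMeasure (halfLine.restrict A) := ⟨by simpa using hA⟩
  LinearMap.mkContinuous
    { toFun := fun f => ∫ t in A, f t ∂halfLine
      map_add' := fun f g => by
        rw [← integral_add (((Lp.memLp f).restrict A).integrable Fact.out)
          (((Lp.memLp g).restrict A).integrable Fact.out)]
        exact integral_congr_ae (ae_restrict_of_ae (Lp.coeFn_add f g))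
      map_smul' := fun c f => by
        rw [RingHom.id_apply, ← integral_smul]
        exact integral_congr_ae (ae_restrict_of_ae (Lp.coeFn_smul c f)) }
    (halfLine A ^ (1 - 1 / p.toReal)).toReal
    (fun f => by
      refine (norm_integral_le_integral_norm _).trans
        ((integral_norm_le_of_memLp p ((Lp.memLp f).restrict A)).trans ?_)
      rw [mul_comm, Measure.restrict_apply_univ, Lp.norm_def]
      gcongr
      · exact (Lp.memLp f).2.ne
      · exact Measure.restrict_le_self)

lemma setIntegralLp_apply (A : Set ℝ) (hA : halfLine A < ∞) (f : Lp ℂ p halfLine) :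
    setIntegralLp p A hA f = ∫ t in A, f t ∂halfLine := rfl

lemma integrable_smul_dilLp {ν : Measure ℝ} {k : ℝ → ℝ} (hk : Integrable k ν)
    (hp' : p ≠ ∞) (f : Lp ℂ p halfLine) :
    Integrable (fun r => k r • dilLp p r f) ν := by
  refine Integrable.mono' (hk.norm.mul_const ‖f‖)
    (hk.1.smul (continuous_dilLp p hp' f).aestronglyMeasurable) ?_
  refine Filter.Eventually.of_forall fun r => ?_
  rw [norm_smul, (dilLp p r).norm_map]

/-- Two locally integrable functions agree almost everywhere once their integrals over all sets of
finite measure agree. Integration over such a set is a bounded functional on `L^p`, so it passes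
through the Bochner integral; Fubini moves it through the pointwise one. -/
lemma integral_smul_dilLp_ae_eq {ν : Measure ℝ} [SFinite ν] {k : ℝ → ℝ}
    (hk : Integrable k ν) (hp' : p ≠ ∞) {g : ℝ → ℂ} (hg : MemLp g p halfLine) :
    (∫ r, k r • dilLp p r (hg.toLp g) ∂ν : Lp ℂ p halfLine) =ᵐ[halfLine]
      fun t => ∫ r, k r • dilation p r g t ∂ν := by
  have hf : ∀ A, halfLine A < ∞ → Integrable
      (∫ r, k r • dilLp p r (hg.toLp g) ∂ν : Lp ℂ p halfLine) (halfLine.restrict A) := by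
    intro A hA
    have : IsFiniteMeasure (halfLine.restrict A) := ⟨by simpa using hA⟩
    exact ((Lp.memLp _).restrict A).integrable Fact.out
  refine ae_eq_of_forall_setIntegral_eq_of_sigmaFinite (fun A _ hA => hf A hA)
    (fun A _ hA => (integrable_smul_dilation_prod p hk hg hA).integral_prod_right)
    fun A _ hA => ?_
  rw [← setIntegralLp_apply p A hA,
    ← ContinuousLinearMap.integral_comp_comm _ (integrable_smul_dilLp p hk hp' _)]
  have h := integral_integral_swap (f := fun r t => k r • dilation p r g t) (integrable_smul_dilation_prod p hk hg hA)
  rw [← h]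
  refine integral_congr_ae (Filter.Eventually.of_forall fun r => ?_)
  simp only [map_smul, setIntegralLp_apply]
  rw [integral_smul, dilLp_toLp]
  congr 1
  exact integral_congr_ae (ae_restrict_of_ae (memLp_dilation p r hg).coeFn_toLp)

end

section

/-! ### Exponential substitutions and the beta kernel -/

section Substitution

variable {F : Type*} [NormedAddCommGroup F] [NormedSpace ℝ F]

lemma image_mul_exp_neg {w : ℝ} (hw : 0 < w) :
    (fun r : ℝ => w * Real.exp (-r)) '' Ioi 0 = Ioo 0 w := by
  ext s
  constructor
  · rintro ⟨r, hr, rfl⟩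
    have hr0 : (0 : ℝ) < r := hr
    exact ⟨by positivity, mul_lt_of_lt_one_right hw (by simpa using hr0)⟩
  · rintro ⟨h0, h1⟩
    refine ⟨-Real.log (s / w), ?_, ?_⟩
    · exact neg_pos.2 (Real.log_neg (by positivity) ((div_lt_one hw).2 h1))
    · simp only [neg_neg]
      rw [Real.exp_log (by positivity), mul_div_cancel₀ _ hw.ne']

lemma image_mul_exp {w : ℝ} (hw : 0 < w) :
    (fun r : ℝ => w * Real.exp r) '' Ioi 0 = Ioi w := by
  ext s
  constructor
  · rintro ⟨r, hr, rfl⟩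
    exact lt_mul_of_one_lt_right hw (Real.one_lt_exp_iff.2 hr)
  · intro h
    have h1 : w < s := h
    have h0 : 0 < s := hw.trans h1
    refine ⟨Real.log (s / w), Real.log_pos ((one_lt_div hw).2 h1), ?_⟩
    simp only
    rw [Real.exp_log (by positivity), mul_div_cancel₀ _ hw.ne']

lemma hasDerivWithinAt_mul_exp_neg (w : ℝ) (r : ℝ) (s : Set ℝ) :
    HasDerivWithinAt (fun r : ℝ => w * Real.exp (-r)) (-(w * Real.exp (-r))) s r := by
  have := ((Real.hasDerivAt_exp (-r)).comp r (hasDerivAt_neg r)).const_mul w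
  exact (this.congr_deriv (by ring)).hasDerivWithinAt

lemma hasDerivWithinAt_mul_exp (w : ℝ) (r : ℝ) (s : Set ℝ) :
    HasDerivWithinAt (fun r : ℝ => w * Real.exp r) (w * Real.exp r) s r :=
  ((Real.hasDerivAt_exp r).const_mul w).hasDerivWithinAt

lemma integrableOn_Ioo_iff_exp_neg {w : ℝ} (hw : 0 < w) (f : ℝ → F) :
    IntegrableOn f (Ioo 0 w) ↔
      IntegrableOn (fun r => (w * Real.exp (-r)) • f (w * Real.exp (-r))) (Ioi 0) := by
  rw [← image_mul_exp_neg hw, integrableOn_image_iff_integrableOn_abs_deriv_smul measurableSet_Ioi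
    (fun r _ => hasDerivWithinAt_mul_exp_neg w r _)
    (fun a _ b _ h => neg_injective (Real.exp_injective (mul_left_cancel₀ hw.ne' h)))]
  simp only [abs_neg, abs_mul, abs_of_pos hw, Real.abs_exp]

lemma integral_Ioo_eq_exp_neg {w : ℝ} (hw : 0 < w) (f : ℝ → F) :
    ∫ s in Ioo 0 w, f s =
      ∫ r in Ioi (0 : ℝ), (w * Real.exp (-r)) • f (w * Real.exp (-r)) := by
  rw [← image_mul_exp_neg hw, integral_image_eq_integral_abs_deriv_smul measurableSet_Ioi
    (fun r _ => hasDerivWithinAt_mul_exp_neg w r _)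
    (fun a _ b _ h => neg_injective (Real.exp_injective (mul_left_cancel₀ hw.ne' h)))]
  simp only [abs_neg, abs_mul, abs_of_pos hw, Real.abs_exp]

lemma integral_Ioi_eq_exp {w : ℝ} (hw : 0 < w) (f : ℝ → F) :
    ∫ s in Ioi w, f s = ∫ r in Ioi (0 : ℝ), (w * Real.exp r) • f (w * Real.exp r) := by
  rw [← image_mul_exp hw, integral_image_eq_integral_abs_deriv_smul measurableSet_Ioi
    (fun r _ => hasDerivWithinAt_mul_exp w r _)
    (fun a _ b _ h => Real.exp_injective (mul_left_cancel₀ hw.ne' h))]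
  simp only [abs_mul, abs_of_pos hw, Real.abs_exp]

end Substitution

/-- The kernel `(1 - e^(-r))^(β - 1) e^(-rδ)`, whose integral over `(0, ∞)` is `B(β, δ)`. -/
def betaKernel (β δ r : ℝ) : ℝ := (1 - Real.exp (-r)) ^ (β - 1) * Real.exp (-r * δ)

lemma betaKernel_nonneg (β δ : ℝ) {r : ℝ} (hr : 0 ≤ r) : 0 ≤ betaKernel β δ r := by
  have : Real.exp (-r) ≤ 1 := Real.exp_le_one_iff.2 (by linarith)
  exact mul_nonneg (Real.rpow_nonneg (by linarith) _) (Real.exp_pos _).le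

lemma measurable_betaKernel (β δ : ℝ) : Measurable (betaKernel β δ) := by
  unfold betaKernel
  fun_prop

lemma betaIntegrand_eq {u v x : ℝ} (hx : x ∈ Ioc (0 : ℝ) 1) :
    (x : ℂ) ^ ((u : ℂ) - 1) * (1 - (x : ℂ)) ^ ((v : ℂ) - 1) =
      ((x ^ (u - 1) * (1 - x) ^ (v - 1) : ℝ) : ℂ) := by
  rw [Complex.ofReal_mul, Complex.ofReal_cpow hx.1.le, Complex.ofReal_cpow (by linarith [hx.2])]
  push_cast
  rfl

lemma integrableOn_betaIntegrand {u v : ℝ} (hu : 0 < u) (hv : 0 < v) :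
    IntegrableOn (fun x : ℝ => x ^ (u - 1) * (1 - x) ^ (v - 1)) (Ioo 0 1) := by
  have h := Complex.betaIntegral_convergent (u := u) (v := v) (by simpa) (by simpa)
  rw [intervalIntegrable_iff_integrableOn_Ioc_of_le zero_le_one] at h
  have h2 := (h.congr_fun (fun x hx => betaIntegrand_eq hx) measurableSet_Ioc).re
  simp only [RCLike.re_to_complex, Complex.ofReal_re] at h2
  exact IntegrableOn.mono_set h2 Ioo_subset_Ioc_self

lemma integral_betaIntegrand {u v : ℝ} (hu : 0 < u) (hv : 0 < v) :
    ∫ x in Ioo (0 : ℝ) 1, x ^ (u - 1) * (1 - x) ^ (v - 1) =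
      Real.Gamma u * Real.Gamma v / Real.Gamma (u + v) := by
  have h := Complex.betaIntegral_eq_Gamma_mul_div u v (by simpa) (by simpa)
  rw [Complex.betaIntegral, intervalIntegral.integral_of_le zero_le_one,
    setIntegral_congr_fun measurableSet_Ioc (fun x hx => betaIntegrand_eq hx),
    integral_complex_ofReal, integral_Ioc_eq_integral_Ioo, ← Complex.ofReal_add,
    Complex.Gamma_ofReal, Complex.Gamma_ofReal, Complex.Gamma_ofReal] at h
  exact_mod_cast h

/-- The factors `1 *` reproduce the shape left by the substitution `x = w e^{-r}` at `w = 1`. -/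
lemma betaKernel_eq (β δ r : ℝ) :
    (1 * Real.exp (-r)) • ((1 * Real.exp (-r)) ^ (δ - 1) * (1 - 1 * Real.exp (-r)) ^ (β - 1)) =
      betaKernel β δ r := by
  rw [one_mul, betaKernel, smul_eq_mul, ← Real.exp_mul, ← mul_assoc, ← Real.exp_add, mul_comm]
  congr 2
  ring

lemma integrableOn_betaKernel {β δ : ℝ} (hβ : 0 < β) (hδ : 0 < δ) :
    IntegrableOn (betaKernel β δ) (Ioi 0) := by
  have h := (integrableOn_Ioo_iff_exp_neg one_pos _).1 (integrableOn_betaIntegrand hδ hβ)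
  simpa only [betaKernel_eq] using h

lemma integral_betaKernel {β δ : ℝ} (hβ : 0 < β) (hδ : 0 < δ) :
    ∫ r in Ioi (0 : ℝ), betaKernel β δ r =
      Real.Gamma β * Real.Gamma δ / Real.Gamma (β + δ) := by
  have h := integral_Ioo_eq_exp_neg one_pos fun x : ℝ => x ^ (δ - 1) * (1 - x) ^ (β - 1)
  rw [integral_betaIntegrand hδ hβ] at h
  simp only [betaKernel_eq] at h
  rw [← h, mul_comm, add_comm]

/-- Half of the exponential decay absorbs the factor `r`, by `r ≤ (2/δ) e^{rδ/2}`. This first moment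
controls the error on approximate fixed vectors. -/
lemma integrableOn_mul_betaKernel {β δ : ℝ} (hβ : 0 < β) (hδ : 0 < δ) :
    IntegrableOn (fun r => r * betaKernel β δ r) (Ioi 0) := by
  refine Integrable.mono' ((integrableOn_betaKernel hβ (half_pos hδ)).const_mul (2 / δ))
    (measurable_id.mul (measurable_betaKernel β δ)).aestronglyMeasurable ?_
  filter_upwards [ae_restrict_mem measurableSet_Ioi] with r hr
  have hr0 : (0 : ℝ) < r := hr
  have h1 : Real.exp (-r) ≤ 1 := Real.exp_le_one_iff.2 (by linarith)
  have h2 : 0 ≤ (1 - Real.exp (-r)) ^ (β - 1) := Real.rpow_nonneg (by linarith) _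
  have h3 : r ≤ 2 / δ * Real.exp (r * (δ / 2)) := by
    have := Real.add_one_le_exp (r * (δ / 2))
    calc r = 2 / δ * (r * (δ / 2)) := by field_simp
      _ ≤ _ := by gcongr; linarith
  rw [Real.norm_of_nonneg (mul_nonneg hr0.le (betaKernel_nonneg β δ hr0.le)), betaKernel,
    betaKernel]
  calc r * ((1 - Real.exp (-r)) ^ (β - 1) * Real.exp (-r * δ))
      ≤ 2 / δ * Real.exp (r * (δ / 2)) *
        ((1 - Real.exp (-r)) ^ (β - 1) * Real.exp (-r * δ)) := by gcongr
    _ = 2 / δ * ((1 - Real.exp (-r)) ^ (β - 1) *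
        (Real.exp (r * (δ / 2)) * Real.exp (-r * δ))) := by ring
    _ = _ := by
      rw [← Real.exp_add]
      congr 3
      ring

lemma scaled_betaKernel_eq (α γ : ℝ) {w r : ℝ} (hw : 0 < w) (hr : 0 < r) :
    (w * Real.exp (-r)) • ((w * Real.exp (-r)) ^ (α - 1) * (w - w * Real.exp (-r)) ^ (γ - 1)) =
      w ^ (α + γ - 1) * betaKernel γ α r := by
  have h1 : Real.exp (-r) ≤ 1 := Real.exp_le_one_iff.2 (by linarith)
  rw [← betaKernel_eq, one_mul, smul_eq_mul, smul_eq_mul,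
    show w - w * Real.exp (-r) = w * (1 - Real.exp (-r)) by ring,
    Real.mul_rpow hw.le (Real.exp_pos _).le, Real.mul_rpow hw.le (by linarith),
    show α + γ - 1 = 1 + (α - 1) + (γ - 1) by ring, Real.rpow_add hw, Real.rpow_add hw,
    Real.rpow_one]
  ring

lemma integrableOn_scaled_betaIntegrand {α γ w : ℝ} (hα : 0 < α) (hγ : 0 < γ) (hw : 0 < w) :
    IntegrableOn (fun u : ℝ => u ^ (α - 1) * (w - u) ^ (γ - 1)) (Ioo 0 w) := by
  rw [integrableOn_Ioo_iff_exp_neg hw, integrableOn_congr_fun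
    (fun r (hr : r ∈ Ioi 0) => scaled_betaKernel_eq α γ hw hr) measurableSet_Ioi]
  exact (integrableOn_betaKernel hγ hα).const_mul _

lemma integral_scaled_betaIntegrand {α γ w : ℝ} (hα : 0 < α) (hγ : 0 < γ) (hw : 0 < w) :
    ∫ u in Ioo 0 w, u ^ (α - 1) * (w - u) ^ (γ - 1) =
      w ^ (α + γ - 1) * (Real.Gamma α * Real.Gamma γ / Real.Gamma (α + γ)) := by
  rw [integral_Ioo_eq_exp_neg hw, setIntegral_congr_fun measurableSet_Ioi
    (fun r (hr : r ∈ Ioi 0) => scaled_betaKernel_eq α γ hw hr), integral_const_mul, integral_betaKernel hγ hα,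
    add_comm γ, mul_comm (Real.Gamma γ)]

end

section

/-! ### The semigroup of Weyl integrals and the inversion formula -/

/-- For `δ > 1` the weight grows at infinity and is absorbed by Schwartz decay of order `n + 2` with
`n ≥ δ - 1`. The semigroup law needs these higher orders. -/
lemma integrableOn_rpow_smul_schwartz {δ : ℝ} (hδ : 0 < δ) (ψ : 𝓢(ℝ, ℂ)) (t : ℝ) :
    IntegrableOn (fun w : ℝ => w ^ (δ - 1) • ψ (w + t)) (Ioi 0) := by
  rcases le_or_gt δ 1 with h1 | h1
  · exact weylIntegral_integrand_integrable ψ hδ h1 t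
  obtain ⟨n, hn⟩ := exists_nat_ge (δ - 1)
  obtain ⟨C, hC, h⟩ := schwartz_decay ψ (n + 2)
  have hw : IntegrableOn (fun u : ℝ => ((1 + u) ^ 2)⁻¹) (Ioi 0) := by
    simpa using weight_integrable zero_lt_one le_rfl
  refine Integrable.mono' (hw.const_mul (C * (1 + |t|) ^ (n + 2)))
    (weylIntegral_integrand_measurable ψ δ t) ?_
  filter_upwards [ae_restrict_mem measurableSet_Ioi] with u hu
  have hu0 : (0 : ℝ) < u := hu
  have e1 : 1 + u ≤ (1 + |t|) * (1 + |u + t|) := by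
    have h2 := abs_sub (u + t) t
    rw [add_sub_cancel_right, abs_of_pos hu0] at h2
    nlinarith [abs_nonneg (u + t), abs_nonneg t]
  have e2 : u ^ (δ - 1) ≤ (1 + u) ^ n := by
    calc u ^ (δ - 1) ≤ (1 + u) ^ (δ - 1) := Real.rpow_le_rpow hu0.le (by linarith) (by linarith)
      _ ≤ (1 + u) ^ (n : ℝ) := Real.rpow_le_rpow_of_exponent_le (by linarith) hn
      _ = (1 + u) ^ n := Real.rpow_natCast _ _
  have e3 : ((1 + |u + t|) ^ (n + 2))⁻¹ ≤ (1 + |t|) ^ (n + 2) * ((1 + u) ^ (n + 2))⁻¹ := by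
    rw [← div_eq_mul_inv, le_div_iff₀ (by positivity), inv_mul_le_iff₀ (by positivity),
      mul_comm, ← mul_pow]
    gcongr
  rw [norm_smul, Real.norm_of_nonneg (by positivity)]
  calc u ^ (δ - 1) * ‖ψ (u + t)‖
      ≤ (1 + u) ^ n * (C * ((1 + |t|) ^ (n + 2) * ((1 + u) ^ (n + 2))⁻¹)) := by
        gcongr
        exact (h _).trans (by gcongr)
    _ = _ := by
      have : (1 + u : ℝ) ≠ 0 := by positivity
      field_simp
      ring

lemma weylIntegral_eq_integral_Ioi (γ : ℝ) (f : ℝ → ℂ) (u t : ℝ) :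
    weylIntegral γ f (u + t) =
      (Real.Gamma γ)⁻¹ • ∫ w in Ioi u, (w - u) ^ (γ - 1) • f (w + t) := by
  unfold weylIntegral
  congr 1
  have h := (measurePreserving_add_right (volume : Measure ℝ) t).setIntegral_preimage_emb
    (measurableEmbedding_addRight t) (fun s => (s - (u + t)) ^ (γ - 1) • f s) (Ioi (u + t))
  simpa using h.symm

/-- The indicator encodes the region `u < w`. Integrating in `u` first gives a beta integral,
leaving `w^{α+γ-1} ‖ψ(w + t)‖`, which is integrable. -/
lemma integrable_weyl_prod {α γ : ℝ} (hα : 0 < α) (hγ : 0 < γ) (ψ : 𝓢(ℝ, ℂ)) (t : ℝ) :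
    Integrable (fun x : ℝ × ℝ =>
      ((Iio x.2).indicator (fun u => u ^ (α - 1) * (x.2 - u) ^ (γ - 1)) x.1) • ψ (x.2 + t))
      (halfLine.prod halfLine) := by
  have hm : AEStronglyMeasurable (fun x : ℝ × ℝ =>
      ((Iio x.2).indicator (fun u => u ^ (α - 1) * (x.2 - u) ^ (γ - 1)) x.1) • ψ (x.2 + t))
      (halfLine.prod halfLine) := by
    have h1 : Measurable fun x : ℝ × ℝ =>
        (Iio x.2).indicator (fun u => u ^ (α - 1) * (x.2 - u) ^ (γ - 1)) x.1 := by
      have : (fun x : ℝ × ℝ =>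
          (Iio x.2).indicator (fun u => u ^ (α - 1) * (x.2 - u) ^ (γ - 1)) x.1) =
          {x : ℝ × ℝ | x.1 < x.2}.indicator
            fun x => x.1 ^ (α - 1) * (x.2 - x.1) ^ (γ - 1) := by
        ext x
        simp [indicator]
      rw [this]
      exact Measurable.indicator (by fun_prop) (measurableSet_lt measurable_fst measurable_snd)
    have h2 : Continuous fun x : ℝ × ℝ => ψ (x.2 + t) := ψ.continuous.comp (by fun_prop)
    exact (h1.smul h2.measurable).aestronglyMeasurable
  have hI : ∀ w : ℝ, 0 < w → IntegrableOn
      ((Iio w).indicator fun u => u ^ (α - 1) * (w - u) ^ (γ - 1)) (Ioi 0) := by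
    intro w hw
    rw [IntegrableOn, integrable_indicator_iff measurableSet_Iio, IntegrableOn,
      Measure.restrict_restrict measurableSet_Iio, inter_comm, Ioi_inter_Iio]
    exact integrableOn_scaled_betaIntegrand hα hγ hw
  refine (integrable_prod_iff' hm).2 ⟨?_, ?_⟩
  · filter_upwards [ae_restrict_mem measurableSet_Ioi] with w hw
    exact (hI w hw).smul_const _
  · refine Integrable.congr ((integrableOn_rpow_smul_schwartz (add_pos hα hγ) ψ t).norm.const_mul
      (Real.Gamma α * Real.Gamma γ / Real.Gamma (α + γ))) ?_
    filter_upwards [ae_restrict_mem measurableSet_Ioi] with w hw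
    have hw0 : (0 : ℝ) < w := hw
    have e : ∀ u ∈ Ioi (0 : ℝ),
        ‖((Iio w).indicator (fun u => u ^ (α - 1) * (w - u) ^ (γ - 1)) u) • ψ (w + t)‖ =
        ((Iio w).indicator (fun u => u ^ (α - 1) * (w - u) ^ (γ - 1)) u) * ‖ψ (w + t)‖ := by
      intro u hu
      have hu0 : (0 : ℝ) < u := hu
      rw [norm_smul, Real.norm_of_nonneg]
      refine indicator_apply_nonneg fun h => ?_
      have : 0 < w - u := sub_pos.2 h
      positivity
    rw [setIntegral_congr_fun measurableSet_Ioi e, integral_mul_const,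
      setIntegral_indicator measurableSet_Iio, Ioi_inter_Iio,
      integral_scaled_betaIntegrand hα hγ hw0, norm_smul, Real.norm_of_nonneg (by positivity)]
    ring

/-- Fubini on `0 < u < w`: the inner integral is `w^{α+γ-1} B(α, γ)`, and the Gamma factors of the
beta function cancel the normalizations. -/
lemma weylIntegral_weylIntegral {α γ : ℝ} (hα : 0 < α) (hγ : 0 < γ) (ψ : 𝓢(ℝ, ℂ)) (t : ℝ) :
    weylIntegral α (weylIntegral γ ψ) t = weylIntegral (α + γ) ψ t := by
  have hGα := (Real.Gamma_pos_of_pos hα).ne'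
  have hGγ := (Real.Gamma_pos_of_pos hγ).ne'
  have hswap := integral_integral_swap (f := fun u w : ℝ =>
    ((Iio w).indicator (fun u => u ^ (α - 1) * (w - u) ^ (γ - 1)) u) • ψ (w + t))
    (integrable_weyl_prod hα hγ ψ t)
  have hR : ∀ w ∈ Ioi (0 : ℝ), ∫ u in Ioi (0 : ℝ),
      ((Iio w).indicator (fun u => u ^ (α - 1) * (w - u) ^ (γ - 1)) u) • ψ (w + t) =
      (Real.Gamma α * Real.Gamma γ / Real.Gamma (α + γ)) • (w ^ (α + γ - 1) • ψ (w + t)) := by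
    intro w hw
    rw [integral_smul_const, setIntegral_indicator measurableSet_Iio, Ioi_inter_Iio,
      integral_scaled_betaIntegrand hα hγ hw, smul_smul, mul_comm]
  have hLft : ∀ u ∈ Ioi (0 : ℝ), ∫ w in Ioi (0 : ℝ),
      ((Iio w).indicator (fun u => u ^ (α - 1) * (w - u) ^ (γ - 1)) u) • ψ (w + t) =
      Real.Gamma γ • (u ^ (α - 1) • weylIntegral γ ψ (u + t)) := by
    intro u hu
    have hu0 : (0 : ℝ) < u := hu
    have e : ∀ w : ℝ,
        ((Iio w).indicator (fun u => u ^ (α - 1) * (w - u) ^ (γ - 1)) u) • ψ (w + t) =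
        (Ioi u).indicator (fun w => u ^ (α - 1) • ((w - u) ^ (γ - 1) • ψ (w + t))) w := by
      intro w
      by_cases h : u < w
      · rw [indicator_of_mem (by exact h), indicator_of_mem (by exact h), mul_smul]
      · rw [indicator_of_notMem (by exact h), indicator_of_notMem (by exact h), zero_smul]
    simp only [e]
    rw [setIntegral_indicator measurableSet_Ioi, Ioi_inter_Ioi, max_eq_right hu0.le,
      integral_smul, weylIntegral_eq_integral_Ioi, smul_comm (Real.Gamma γ),
      smul_inv_smul₀ hGγ]
  rw [setIntegral_congr_fun measurableSet_Ioi hLft, setIntegral_congr_fun measurableSet_Ioi hR,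
    integral_smul, integral_smul] at hswap
  rw [weylIntegral_shift, weylIntegral_shift]
  rw [← smul_right_injective ℂ hGγ |>.eq_iff, smul_comm, hswap, smul_smul, smul_smul]
  congr 1
  field_simp

lemma weylIntegral_one_deriv (φ : 𝓢(ℝ, ℂ)) :
    weylIntegral 1 (SchwartzMap.derivCLM ℂ ℂ φ) = fun t => -φ t := by
  funext t
  have h := integral_Ioi_of_hasDerivAt_of_tendsto' (a := t) (f := φ)
    (f' := SchwartzMap.derivCLM ℂ ℂ φ) (m := 0)
    (fun x _ => by
      rw [SchwartzMap.derivCLM_apply]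
      exact (φ.differentiable x).hasDerivAt)
    (SchwartzMap.integrable _).integrableOn
    (φ.tendsto_cocompact.mono_left _root_.atTop_le_cocompact)
  simpa [weylIntegral] using h

lemma weylIntegral_const_mul (γ : ℝ) (c : ℂ) (f : ℝ → ℂ) (t : ℝ) :
    weylIntegral γ (fun s => c * f s) t = c * weylIntegral γ f t := by
  have h : ∀ s : ℝ, (s - t) ^ (γ - 1) • (c * f s) = c * (s - t) ^ (γ - 1) • f s :=
    fun s => (mul_smul_comm _ _ _).symm
  simp only [weylIntegral, h]
  rw [integral_const_mul, mul_smul_comm]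

/-- The induction starts at order `1` because `weylIntegral 0` is the zero map, not the identity,
`Real.Gamma 0` being `0`. -/
lemma weylIntegral_nat_iterate_deriv (n : ℕ) (φ : 𝓢(ℝ, ℂ)) (t : ℝ) :
    weylIntegral ((n + 1 : ℕ) : ℝ) ((SchwartzMap.derivCLM ℂ ℂ)^[n + 1] φ) t =
      (-1) ^ (n + 1) * φ t := by
  induction n with
  | zero => simp [weylIntegral_one_deriv]
  | succ n ih =>
    have h := weylIntegral_weylIntegral (α := ((n + 1 : ℕ) : ℝ)) (γ := 1) (by positivity) one_pos
      ((SchwartzMap.derivCLM ℂ ℂ)^[n + 1 + 1] φ) t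
    rw [Nat.cast_succ (n + 1), ← h, Function.iterate_succ_apply', weylIntegral_one_deriv]
    have h2 := weylIntegral_const_mul ((n + 1 : ℕ) : ℝ) (-1)
      ((SchwartzMap.derivCLM ℂ ℂ)^[n + 1] φ) t
    simp only [neg_one_mul] at h2
    rw [h2, ih, pow_succ _ (n + 1)]
    ring

/-- With `n = [α] + 1`, `W_+^α φ` is `(-1)^n W_+^{-(n-α)} φ^{(n)}`; the semigroup law raises the
order to `n`, and `n` integrations undo `n` derivatives. -/
lemma weylIntegral_weylDeriv {α : ℝ≥0} (hα : 0 < α) (φ : 𝓢(ℝ, ℂ)) (t : ℝ) :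
    weylIntegral α (weylDeriv α φ) t = φ t := by
  rw [weylDeriv_schwartz, weylIntegral_const_mul,
    weylIntegral_weylIntegral (by exact_mod_cast hα) (order_pos α), add_sub_cancel,
    weylIntegral_nat_iterate_deriv, ← mul_assoc, ← mul_pow]
  simp

lemma weylDeriv_zero (φ : 𝓢(ℝ, ℂ)) : weylDeriv 0 φ = φ := by
  have h := weylDeriv_schwartz 0 φ
  funext t
  have h1 := congrFun h t
  simpa [weylIntegral_one_deriv] using h1

lemma weightedDeriv_zero (φ : 𝓢(ℝ, ℂ)) : weightedDeriv 0 φ = φ := by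
  funext t
  simp [weightedDeriv, weylDeriv_zero]

/-- The inversion formula after `s = t e^{-r}`, with `α / Γ(α + 1) = 1 / Γ(α)`. Here `r ≤ 0` because
the Weyl integral at `t` looks at `s > t`. -/
lemma eq_integral_dilation_weightedDeriv {α : ℝ≥0} (hα : 0 < α) (p : ℝ≥0∞) (φ : 𝓢(ℝ, ℂ))
    {t : ℝ} (ht : 0 < t) :
    φ t = (α : ℝ) • ∫ r in Iic (0 : ℝ),
      betaKernel α (1 / p.toReal) (-r) • dilation p r (weightedDeriv α φ) t := by
  have hα' : (0 : ℝ) < α := by exact_mod_cast hα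
  have hG := (Real.Gamma_pos_of_pos hα').ne'
  have h := integral_comp_neg_Iic 0 fun x : ℝ =>
    betaKernel α (1 / p.toReal) x • dilation p (-x) (weightedDeriv α φ) t
  simp only [neg_neg, neg_zero] at h
  rw [h, ← weylIntegral_weylDeriv hα φ t, weylIntegral, integral_Ioi_eq_exp ht, ← integral_smul,
    ← integral_smul]
  refine setIntegral_congr_fun measurableSet_Ioi fun x hx => ?_
  have hx0 : (0 : ℝ) < x := hx
  have h1 : Real.exp (-x) ≤ 1 := Real.exp_le_one_iff.2 (by linarith)
  have e1 : t * Real.exp x - t = t * Real.exp x * (1 - Real.exp (-x)) := by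
    rw [mul_sub, mul_assoc t _ (Real.exp (-x)), ← Real.exp_add]
    simp
  have e2 : (t * Real.exp x) ^ (α : ℝ) = t * Real.exp x * (t * Real.exp x) ^ ((α : ℝ) - 1) := by
    rw [Real.rpow_sub_one (by positivity)]
    field_simp
  have e3 : Real.exp (-(x / p.toReal)) * Real.exp (x / p.toReal) = 1 := by
    rw [← Real.exp_add]
    simp
  simp only [dilation, weightedDeriv, neg_neg, betaKernel, smul_smul]
  rw [mul_comm (Real.exp x) t, e1, Real.mul_rpow (by positivity) (by linarith), e2,
    Real.Gamma_add_one hα'.ne']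
  congr 1
  field_simp
  rw [mul_assoc, e3, mul_one]

end

section

/-! ### The embedding into `L^p(ℝ⁺)` and the dilation group on the Sobolev space -/

lemma norm_integral_smul_le {X : Type*} [NormedAddCommGroup X] [NormedSpace ℝ X]
    {ν : Measure ℝ} {k : ℝ → ℝ} (hk : Integrable k ν) {F : ℝ → X} {B : ℝ}
    (hF : ∀ r, ‖F r‖ ≤ B) : ‖∫ r, k r • F r ∂ν‖ ≤ (∫ r, ‖k r‖ ∂ν) * B := by
  rw [← integral_mul_const]
  refine norm_integral_le_of_norm_le (hk.norm.mul_const B)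
    (Filter.Eventually.of_forall fun r => ?_)
  rw [norm_smul]
  gcongr
  exact hF r

lemma integrableOn_betaKernel_neg {β δ : ℝ} (hβ : 0 < β) (hδ : 0 < δ) :
    IntegrableOn (fun r => betaKernel β δ (-r)) (Iic 0) := by
  rw [integrableOn_Iic_iff_integrableOn_Iio]
  have h := ((Measure.measurePreserving_neg (volume : Measure ℝ)).integrableOn_comp_preimage
    (Homeomorph.neg ℝ).measurableEmbedding).2 (integrableOn_betaKernel hβ hδ)
  simpa [Function.comp_def] using h

variable (α : ℝ≥0) (p : ℝ≥0∞)

lemma coeFn_inclusionLp (φ : SchwartzHalf α p) :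
    inclusionLp α p φ =ᵐ[halfLine] toSchwartz α p φ :=
  ((SchwartzMap.memLp (toSchwartz α p φ) p volume).restrict (Ioi 0)).coeFn_toLp

lemma toSchwartz_dilationSchwartz_apply (r : ℝ) (φ : SchwartzHalf α p) (s : ℝ) :
    toSchwartz α p (dilationSchwartz α p r φ) s = dilation p r (toSchwartz α p φ) s := by
  have h2 : toSchwartz α p (dilationSchwartz α p r φ) =
      (Real.exp (-r / p.toReal) : ℂ) • compScaling r (toSchwartz α p φ) := by
    simp [dilationSchwartz]
  rw [h2, smul_apply, compScaling_apply, dilation, smul_eq_mul, Complex.real_smul]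

variable [Fact (1 ≤ p)]

lemma coeFn_derivLp (φ : SchwartzHalf α p) :
    derivLp α p φ =ᵐ[halfLine] weightedDeriv α (toSchwartz α p φ) :=
  (weightedDeriv_memLp α p (toSchwartz α p φ)).coeFn_toLp

lemma inclusionLp_eq_integral {α : ℝ≥0} (hα : 0 < α) (hp' : p ≠ ∞) (φ : SchwartzHalf α p) :
    inclusionLp α p φ = (α : ℝ) • ∫ r in Iic (0 : ℝ),
      betaKernel α (1 / p.toReal) (-r) • dilLp p r (derivLp α p φ) := by
  have hp0 : p ≠ 0 := (zero_lt_one.trans_le (Fact.out : 1 ≤ p)).ne'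
  have hp1 : 0 < p.toReal := ENNReal.toReal_pos hp0 hp'
  have hk := integrableOn_betaKernel_neg (NNReal.coe_pos.2 hα) (one_div_pos.2 hp1)
  have h := integral_smul_dilLp_ae_eq p hk hp' (weightedDeriv_memLp α p (toSchwartz α p φ))
  refine Lp.ext ?_
  refine (coeFn_inclusionLp α p φ).trans ?_
  refine Filter.EventuallyEq.trans ?_ (Lp.coeFn_smul _ _).symm
  filter_upwards [h, ae_restrict_mem measurableSet_Ioi] with t ht ht0
  rw [eq_integral_dilation_weightedDeriv hα p _ ht0, Pi.smul_apply, ← ht]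
  rfl

/-- For `α = 0` the inclusion is `D_+^0` itself; for `α > 0` it is an average of isometries applied
to `D_+^α φ`. -/
lemma exists_norm_inclusionLp_le (hp' : p ≠ ∞) :
    ∃ K : ℝ, ∀ φ : SchwartzHalf α p, ‖inclusionLp α p φ‖ ≤ K * ‖φ‖ := by
  rcases eq_zero_or_pos α with rfl | hα
  · refine ⟨1, fun φ => ?_⟩
    have : inclusionLp 0 p φ = derivLp 0 p φ := by
      refine Lp.ext ((coeFn_inclusionLp 0 p φ).trans ?_)
      refine Filter.EventuallyEq.trans (Filter.EventuallyEq.of_eq ?_) (coeFn_derivLp 0 p φ).symm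
      exact (weightedDeriv_zero _).symm
    rw [this, one_mul]
    exact le_rfl
  · refine ⟨(α : ℝ) * ∫ r in Iic (0 : ℝ), ‖betaKernel α (1 / p.toReal) (-r)‖, fun φ => ?_⟩
    have hp0 : p ≠ 0 := (zero_lt_one.trans_le (Fact.out : 1 ≤ p)).ne'
    have hk := integrableOn_betaKernel_neg (NNReal.coe_pos.2 hα)
      (one_div_pos.2 (ENNReal.toReal_pos hp0 hp'))
    rw [inclusionLp_eq_integral p hα hp', norm_smul, Real.norm_of_nonneg α.coe_nonneg, mul_assoc]
    gcongr
    exact norm_integral_smul_le hk fun r => ((dilLp p r).norm_map _).le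

/-- The inclusion of `S_+` into `L^p(ℝ⁺)` as a continuous linear map. -/
def inclusionCLM (hp' : p ≠ ∞) : SchwartzHalf α p →L[ℂ] Lp ℂ p halfLine :=
  LinearMap.mkContinuousOfExistsBound
    { toFun := inclusionLp α p
      map_add' := fun _ _ => rfl
      map_smul' := fun _ _ => rfl }
    (exists_norm_inclusionLp_le α p hp')

lemma uniformContinuous_inclusionLp (hp' : p ≠ ∞) : UniformContinuous (inclusionLp α p) :=
  (inclusionCLM α p hp').uniformContinuous

/-- `toLp` as a continuous linear map. -/
def toLpCLM (hp' : p ≠ ∞) : SobolevT α p →L[ℂ] Lp ℂ p halfLine :=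
  (inclusionCLM α p hp').fromCompletion

lemma toLpCLM_apply (hp' : p ≠ ∞) (f : SobolevT α p) : toLpCLM α p hp' f = toLp α p f :=
  congrFun (ContinuousLinearMap.coe_fromCompletion (inclusionCLM α p hp')) f

lemma toLpCLM_coe (hp' : p ≠ ∞) (φ : SchwartzHalf α p) :
    toLpCLM α p hp' φ = inclusionLp α p φ :=
  ContinuousLinearMap.fromCompletion_apply_coe (inclusionCLM α p hp') φ

/-- `D_+^α : S_+ → L^p(ℝ⁺)` as a linear isometry. -/
def derivIsometry : SchwartzHalf α p →ₗᵢ[ℂ] Lp ℂ p halfLine := ⟨derivLp α p, fun _ => rfl⟩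

/-- The extension of `D_+^α` to the Sobolev space. -/
def derivT : SobolevT α p →L[ℂ] Lp ℂ p halfLine :=
  (derivIsometry α p).toContinuousLinearMap.fromCompletion

lemma derivT_coe (φ : SchwartzHalf α p) : derivT α p φ = derivLp α p φ :=
  ContinuousLinearMap.fromCompletion_apply_coe (derivIsometry α p).toContinuousLinearMap φ

/-- The norm on `S_+` is pulled back along `D_+^α`. Identities and continuity in the Sobolev space
can therefore be checked in `L^p` after applying `derivT`. -/
lemma norm_derivT (f : SobolevT α p) : ‖derivT α p f‖ = ‖f‖ := by
  induction f using UniformSpace.Completion.induction_on with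
  | hp => exact isClosed_eq (derivT α p).continuous.norm continuous_norm
  | ih φ => rw [derivT_coe, UniformSpace.Completion.norm_coe]; rfl

lemma isometry_derivT : Isometry (derivT α p) :=
  AddMonoidHomClass.isometry_of_norm _ (norm_derivT α p)

lemma dilationT_coe (r : ℝ) (φ : SchwartzHalf α p) :
    dilationT α p r φ = (dilationSchwartz α p r φ : SchwartzHalf α p) :=
  ContinuousLinearMap.completion_apply_coe _ φ

lemma inclusionLp_dilationSchwartz (r : ℝ) (φ : SchwartzHalf α p) :
    inclusionLp α p (dilationSchwartz α p r φ) = dilLp p r (inclusionLp α p φ) := by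
  rw [inclusionLp, inclusionLp, dilLp_toLp]
  exact MemLp.toLp_congr _ _ (Filter.Eventually.of_forall
    (toSchwartz_dilationSchwartz_apply α p r φ))

lemma derivLp_dilationSchwartz (r : ℝ) (φ : SchwartzHalf α p) :
    derivLp α p (dilationSchwartz α p r φ) = dilLp p r (derivLp α p φ) := by
  have h1 : derivLp α p φ = (weightedDeriv_memLp α p (toSchwartz α p φ)).toLp _ := rfl
  rw [h1, dilLp_toLp]
  refine MemLp.toLp_congr (weightedDeriv_memLp α p
    (toSchwartz α p (dilationSchwartz α p r φ))) _ ?_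
  filter_upwards [ae_restrict_mem measurableSet_Ioi] with t ht
  have h2 : toSchwartz α p (dilationSchwartz α p r φ) =
      (Real.exp (-r / p.toReal) : ℂ) • compScaling r (toSchwartz α p φ) := by
    simp [dilationSchwartz]
  rw [h2, weightedDeriv_smul, Pi.smul_apply,
    weightedDeriv_scale α (toSchwartz α p φ) _ (Real.exp_pos (-r))
      (compScaling_apply r (toSchwartz α p φ)) ht]
  rfl

/-- Scaling the variable by `c` multiplies `W_+^α` by `c^α`, which the weight `t^α` absorbs; density
does the rest. -/
lemma derivT_dilationT (r : ℝ) (f : SobolevT α p) :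
    derivT α p (dilationT α p r f) = dilLp p r (derivT α p f) := by
  induction f using UniformSpace.Completion.induction_on with
  | hp =>
    exact isClosed_eq ((derivT α p).continuous.comp (dilationT α p r).continuous)
      ((dilLp p r).continuous.comp (derivT α p).continuous)
  | ih φ => rw [dilationT_coe, derivT_coe, derivT_coe, derivLp_dilationSchwartz]

lemma toLp_dilationT (hp' : p ≠ ∞) (r : ℝ) (f : SobolevT α p) :
    toLp α p (dilationT α p r f) = dilLp p r (toLp α p f) := by
  rw [← toLpCLM_apply α p hp', ← toLpCLM_apply α p hp']
  induction f using UniformSpace.Completion.induction_on with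
  | hp =>
    exact isClosed_eq ((toLpCLM α p hp').continuous.comp (dilationT α p r).continuous)
      ((dilLp p r).continuous.comp (toLpCLM α p hp').continuous)
  | ih φ => rw [dilationT_coe, toLpCLM_coe, toLpCLM_coe, inclusionLp_dilationSchwartz]

lemma norm_dilationT (r : ℝ) (f : SobolevT α p) : ‖dilationT α p r f‖ = ‖f‖ := by
  rw [← norm_derivT, derivT_dilationT, (dilLp p r).norm_map, norm_derivT]

lemma dilLp_dilLp (r s : ℝ) (f : Lp ℂ p halfLine) :
    dilLp p r (dilLp p s f) = dilLp p (r + s) f := by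
  refine Lp.ext ((coeFn_dilLp p r _).trans ((dilation_congr_ae p r (coeFn_dilLp p s f)).trans
    (Filter.EventuallyEq.trans (Filter.Eventually.of_forall fun t => ?_)
      (coeFn_dilLp p (r + s) f).symm)))
  have h1 : Real.exp (-(r + s) / p.toReal) =
      Real.exp (-r / p.toReal) * Real.exp (-s / p.toReal) := by
    rw [← Real.exp_add]
    ring_nf
  have h2 : Real.exp (-(r + s)) * t = Real.exp (-s) * (Real.exp (-r) * t) := by
    rw [← mul_assoc, ← Real.exp_add]
    ring_nf
  simp only [dilation, smul_smul, h1, h2]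

lemma dilationT_dilationT (r s : ℝ) (f : SobolevT α p) :
    dilationT α p r (dilationT α p s f) = dilationT α p (r + s) f := by
  refine (isometry_derivT α p).injective ?_
  rw [derivT_dilationT, derivT_dilationT, derivT_dilationT, dilLp_dilLp]

lemma continuous_dilationT (hp' : p ≠ ∞) (f : SobolevT α p) :
    Continuous fun r => dilationT α p r f := by
  refine (isometry_derivT α p).comp_continuous_iff.1 ?_
  have := continuous_dilLp p hp' (derivT α p f)
  simpa only [Function.comp_def, derivT_dilationT] using this

lemma integrable_smul_dilationT (hp' : p ≠ ∞) {ν : Measure ℝ} {k : ℝ → ℝ} (hk : Integrable k ν)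
    (f : SobolevT α p) : Integrable (fun r => k r • dilationT α p r f) ν := by
  refine Integrable.mono' (hk.norm.mul_const ‖f‖)
    (hk.1.smul (continuous_dilationT α p hp' f).aestronglyMeasurable) ?_
  refine Filter.Eventually.of_forall fun r => ?_
  rw [norm_smul, norm_dilationT]

lemma toLp_integral_smul_dilationT (hp' : p ≠ ∞) {ν : Measure ℝ} {k : ℝ → ℝ}
    (hk : Integrable k ν) (f : SobolevT α p) :
    toLp α p (∫ r, k r • dilationT α p r f ∂ν) = ∫ r, k r • dilLp p r (toLp α p f) ∂ν := by
  rw [← toLpCLM_apply α p hp',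
    ← ContinuousLinearMap.integral_comp_comm _ (integrable_smul_dilationT α p hp' hk f)]
  congr 1
  funext r
  rw [← toLp_dilationT α p hp', ← toLpCLM_apply α p hp']
  exact map_real_smul _ (toLpCLM α p hp').continuous _ _

end

section

/-! ### The generalized Cesàro operator on functions -/

/-- The Jacobian `e^{-r}` splits as `e^{-r(1-1/p)} e^{-r/p}`: one factor goes to the kernel, the
other normalizes the dilation. -/
lemma cesaro_integrand_eq (p : ℝ≥0∞) (β : ℝ) (g : ℝ → ℂ) {t r : ℝ} (ht : 0 < t) (hr : 0 < r) :
    (t * Real.exp (-r)) • (t - t * Real.exp (-r)) ^ (β - 1) • g (t * Real.exp (-r)) =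
      t ^ β • kernel p β r • dilation p r g t := by
  have h1 : Real.exp (-r) ≤ 1 := Real.exp_le_one_iff.2 (by linarith)
  have e1 : t ^ β = t * t ^ (β - 1) := by
    rw [Real.rpow_sub_one ht.ne']
    field_simp
  have e2 : Real.exp (-r) = Real.exp (-r * (1 - 1 / p.toReal)) * Real.exp (-r / p.toReal) := by
    rw [← Real.exp_add]
    ring_nf
  rw [show t - t * Real.exp (-r) = t * (1 - Real.exp (-r)) by ring,
    Real.mul_rpow ht.le (by linarith), e1, dilation, kernel, mul_comm t (Real.exp (-r))]
  simp only [smul_smul]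
  congr 1
  rw [mul_comm (Real.exp (-r)) t]
  nth_rewrite 1 [e2]
  ring

lemma integrableOn_cesaro_iff (p : ℝ≥0∞) (β : ℝ) (g : ℝ → ℂ) {t : ℝ} (ht : 0 < t) :
    IntegrableOn (fun s => (t - s) ^ (β - 1) • g s) (Ioo 0 t) ↔
      IntegrableOn (fun r => kernel p β r • dilation p r g t) (Ioi 0) := by
  rw [integrableOn_Ioo_iff_exp_neg ht, integrableOn_congr_fun
    (fun r (hr : r ∈ Ioi 0) => cesaro_integrand_eq p β g ht hr) measurableSet_Ioi]
  exact integrable_smul_iff (Real.rpow_pos_of_pos ht β).ne' _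

/-- The change of variables needs no integrability, both integrals being `0` when divergent, so the
identity holds at every `t > 0` and for every `g`. -/
lemma cesaro_eq_integral_dilation (p : ℝ≥0∞) (β : ℝ) (g : ℝ → ℂ) {t : ℝ} (ht : 0 < t) :
    cesaro β g t = β • ∫ r in Ioi (0 : ℝ), kernel p β r • dilation p r g t := by
  rw [cesaro, integral_Ioo_eq_exp_neg ht, setIntegral_congr_fun measurableSet_Ioi
    (fun r (hr : r ∈ Ioi 0) => cesaro_integrand_eq p β g ht hr), integral_smul, smul_smul,
    div_mul_cancel₀ _ (Real.rpow_pos_of_pos ht β).ne']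

/-! ### A positive test function -/

/-- A nonnegative smooth function with compact support which equals `1` on `[1, 3]`. -/
def testBump : ContDiffBump (2 : ℝ) := ⟨1, 2, one_pos, one_lt_two⟩

/-- `testBump` as a Schwartz function. -/
def testSchwartz : 𝓢(ℝ, ℂ) :=
  (testBump.hasCompactSupport.comp_left (g := ((↑) : ℝ → ℂ)) Complex.ofReal_zero).toSchwartzMap
    (Complex.ofRealCLM.contDiff.comp testBump.contDiff)

lemma testSchwartz_apply (x : ℝ) : testSchwartz x = ((testBump x : ℝ) : ℂ) := rfl

/-- On the unit interval `log t - 1 < r ≤ log t` the point `e^{-r} t` lies in `[1, e)`, where the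
bump equals `1`, and `e^{-r/p} ≥ t^{-1/p}`. -/
lemma le_norm_integral_dilation_testSchwartz (p : ℝ≥0∞) {N t : ℝ} (h1 : Real.exp 1 ≤ t)
    (h2 : t ≤ Real.exp N) :
    t ^ (-(1 / p.toReal)) ≤ ‖∫ r in Ioc 0 N, dilation p r testSchwartz t‖ := by
  have ht : 0 < t := (Real.exp_pos 1).trans_le h1
  have hl1 : 1 ≤ Real.log t := (Real.le_log_iff_exp_le ht).2 h1
  have hl2 : Real.log t ≤ N := (Real.log_le_iff_le_exp ht).2 h2
  set b : ℝ → ℝ := fun r => Real.exp (-r / p.toReal) * testBump (Real.exp (-r) * t) with hb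
  have hb0 : ∀ r, 0 ≤ b r := fun r => mul_nonneg (Real.exp_pos _).le testBump.nonneg
  have hbc : Continuous b := by
    have := testBump.continuous
    fun_prop
  have e : ∀ r, dilation p r testSchwartz t = ((b r : ℝ) : ℂ) := by
    intro r
    simp [dilation, testSchwartz_apply, hb]
  simp only [e]
  rw [integral_complex_ofReal, Complex.norm_real,
    Real.norm_of_nonneg (integral_nonneg hb0)]
  have hsub : Ioc (Real.log t - 1) (Real.log t) ⊆ Ioc 0 N :=
    Ioc_subset_Ioc (by linarith) hl2
  calc t ^ (-(1 / p.toReal))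
      = ∫ _ in Ioc (Real.log t - 1) (Real.log t), t ^ (-(1 / p.toReal)) := by simp
    _ ≤ ∫ r in Ioc (Real.log t - 1) (Real.log t), b r := by
      refine setIntegral_mono_on (by simp) (hbc.integrableOn_Ioc) measurableSet_Ioc
        fun r hr => ?_
      have e1 : Real.exp (-r) * t = Real.exp (Real.log t - r) := by
        rw [sub_eq_neg_add, Real.exp_add, Real.exp_log ht]
      have e2 : testBump (Real.exp (-r) * t) = 1 := by
        refine testBump.one_of_mem_closedBall ?_
        rw [e1, Metric.mem_closedBall, Real.dist_eq]
        change _ ≤ (1 : ℝ)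
        have l1 : 1 ≤ Real.exp (Real.log t - r) := Real.one_le_exp (by linarith [hr.2])
        have l2 : Real.exp (Real.log t - r) ≤ Real.exp 1 :=
          Real.exp_le_exp.2 (by linarith [hr.1])
        have l3 := Real.exp_one_lt_d9
        rw [abs_le]
        constructor <;> linarith
      rw [hb]
      simp only [e2, mul_one]
      rw [Real.rpow_def_of_pos ht, Real.exp_le_exp]
      have hp0 : 0 ≤ 1 / p.toReal := by positivity
      have := mul_le_mul_of_nonneg_right hr.2 hp0
      rw [div_eq_mul_one_div (-r)]
      linarith
    _ ≤ ∫ r in Ioc 0 N, b r :=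
      setIntegral_mono_set hbc.integrableOn_Ioc (Filter.Eventually.of_forall hb0)
        hsub.eventuallyLE

/-! ### The operator on the Sobolev space -/

variable (α : ℝ≥0) (p : ℝ≥0∞)

lemma one_sub_inv_toReal_pos (hp : 1 < p) (hp' : p ≠ ∞) : 0 < 1 - 1 / p.toReal := by
  have h : 1 < p.toReal := by
    rw [← ENNReal.toReal_one]
    exact ENNReal.toReal_strict_mono hp' hp
  rw [sub_pos, div_lt_one (by linarith)]
  exact h

lemma integrableOn_kernel (hp : 1 < p) (hp' : p ≠ ∞) {β : ℝ} (hβ : 0 < β) :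
    IntegrableOn (kernel p β) (Ioi 0) :=
  integrableOn_betaKernel hβ (one_sub_inv_toReal_pos p hp hp')

lemma integral_kernel (hp : 1 < p) (hp' : p ≠ ∞) {β : ℝ} (hβ : 0 < β) :
    β * ∫ r in Ioi (0 : ℝ), kernel p β r =
      Real.Gamma (β + 1) * Real.Gamma (1 - 1 / p.toReal) /
        Real.Gamma (β + 1 - 1 / p.toReal) := by
  have h := integral_betaKernel hβ (one_sub_inv_toReal_pos p hp hp')
  rw [Real.Gamma_add_one hβ.ne', ← add_sub_assoc] at *
  rw [mul_assoc, mul_div_assoc, ← h]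
  rfl

variable [Fact (1 ≤ p)]

/-- The generalized Cesàro operator on the Sobolev space. -/
def cesaroT (hp : 1 < p) (hp' : p ≠ ∞) {β : ℝ} (hβ : 0 < β) :
    SobolevT α p →L[ℂ] SobolevT α p :=
  LinearMap.mkContinuous
    { toFun := fun f => β • ∫ r in Ioi (0 : ℝ), kernel p β r • dilationT α p r f
      map_add' := fun f g => by
        simp only [map_add, smul_add]
        rw [integral_add (integrable_smul_dilationT α p hp' (integrableOn_kernel p hp hp' hβ) f)
          (integrable_smul_dilationT α p hp' (integrableOn_kernel p hp hp' hβ) g), smul_add]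
      map_smul' := fun c f => by
        simp only [map_smul, RingHom.id_apply, smul_comm _ c, integral_smul] }
    (β * ∫ r in Ioi (0 : ℝ), ‖kernel p β r‖)
    (fun f => by
      rw [LinearMap.coe_mk, AddHom.coe_mk, norm_smul, Real.norm_of_nonneg hβ.le, mul_assoc]
      gcongr
      exact norm_integral_smul_le (integrableOn_kernel p hp hp' hβ)
        fun r => (norm_dilationT α p r f).le)

lemma cesaroT_apply (hp : 1 < p) (hp' : p ≠ ∞) {β : ℝ} (hβ : 0 < β) (f : SobolevT α p) :
    cesaroT α p hp hp' hβ f = β • ∫ r in Ioi (0 : ℝ), kernel p β r • dilationT α p r f := rfl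

lemma toLp_cesaroT (hp : 1 < p) (hp' : p ≠ ∞) {β : ℝ} (hβ : 0 < β) (f : SobolevT α p) :
    toLp α p (cesaroT α p hp hp' hβ f) =ᵐ[halfLine] cesaro β (toLp α p f) := by
  have hk := integrableOn_kernel p hp hp' hβ
  have h1 : toLp α p (cesaroT α p hp hp' hβ f) =
      β • ∫ r in Ioi (0 : ℝ), kernel p β r • dilLp p r (toLp α p f) := by
    rw [cesaroT_apply, ← toLp_integral_smul_dilationT α p hp' hk, ← toLpCLM_apply α p hp',
      ← toLpCLM_apply α p hp']
    exact map_real_smul _ (toLpCLM α p hp').continuous _ _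
  have h2 := integral_smul_dilLp_ae_eq p hk hp' (Lp.memLp (toLp α p f))
  rw [Lp.toLp_coeFn] at h2
  rw [h1]
  refine (Lp.coeFn_smul _ _).trans ?_
  filter_upwards [h2, ae_restrict_mem measurableSet_Ioi] with t ht ht0
  rw [cesaro_eq_integral_dilation p β _ ht0, Pi.smul_apply, ht]

lemma norm_cesaroT_le (hp : 1 < p) (hp' : p ≠ ∞) {β : ℝ} (hβ : 0 < β) :
    ‖cesaroT α p hp hp' hβ‖ ≤ β * ∫ r in Ioi (0 : ℝ), kernel p β r := by
  have h : ∫ r in Ioi (0 : ℝ), ‖kernel p β r‖ = ∫ r in Ioi (0 : ℝ), kernel p β r :=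
    setIntegral_congr_fun measurableSet_Ioi fun r (hr : 0 < r) =>
      Real.norm_of_nonneg (betaKernel_nonneg β _ hr.le)
  rw [← h]
  exact LinearMap.mkContinuous_norm_le _
    (mul_nonneg hβ.le (integral_nonneg fun r => norm_nonneg _)) _

/-! ### Approximate fixed vectors of the dilation group -/

/-- The integral `∫_0^N T_{r,p} f dr` of an orbit. -/
def orbitIntegral (N : ℝ) (f : SobolevT α p) : SobolevT α p := ∫ r in (0 : ℝ)..N, dilationT α p r f

/-- `T_h` shifts the window `[0, N]` to `[h, h + N]`, and the two integrals differ by two pieces of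
length `h`. The bound is independent of `N`. -/
lemma norm_dilationT_orbitIntegral_sub_le (hp' : p ≠ ∞) (N : ℝ) (f : SobolevT α p) {h : ℝ}
    (hh : 0 ≤ h) :
    ‖dilationT α p h (orbitIntegral α p N f) - orbitIntegral α p N f‖ ≤ h * (2 * ‖f‖) := by
  have hc := continuous_dilationT α p hp' f
  have hi : ∀ a b : ℝ, IntervalIntegrable (fun r => dilationT α p r f) volume a b :=
    fun a b => hc.intervalIntegrable a b
  have h1 : dilationT α p h (orbitIntegral α p N f) = ∫ r in h..h + N, dilationT α p r f := by
    rw [orbitIntegral, ← ContinuousLinearMap.intervalIntegral_comp_comm _ (hi 0 N)]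
    simp only [dilationT_dilationT]
    rw [intervalIntegral.integral_comp_add_left (fun r => dilationT α p r f) h, add_zero]
  have hb : ∀ a b : ℝ, ‖∫ r in a..b, dilationT α p r f‖ ≤ ‖f‖ * |b - a| := fun a b =>
    intervalIntegral.norm_integral_le_of_norm_le_const fun r _ => (norm_dilationT α p r f).le
  rw [h1, orbitIntegral,
    intervalIntegral.integral_interval_sub_interval_comm (hi _ _) (hi _ _) (hi _ _)]
  refine (norm_sub_le _ _).trans ((add_le_add (hb _ _) (hb _ _)).trans_eq ?_)
  rw [zero_sub, abs_neg, show N - (h + N) = -h by ring, abs_neg, abs_of_nonneg hh]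
  ring

/-- The difference is `β ∫ k(r) (T_r F - F) dr`, bounded by the first moment of the kernel, again
independently of `N`. -/
lemma norm_cesaroT_orbitIntegral_sub_le (hp : 1 < p) (hp' : p ≠ ∞) {β : ℝ} (hβ : 0 < β) (N : ℝ)
    (f : SobolevT α p) :
    ‖cesaroT α p hp hp' hβ (orbitIntegral α p N f) -
      (β * ∫ r in Ioi (0 : ℝ), kernel p β r) • orbitIntegral α p N f‖ ≤
    β * ((∫ r in Ioi (0 : ℝ), r * kernel p β r) * (2 * ‖f‖)) := by
  have hk := integrableOn_kernel p hp hp' hβ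
  have hk2 : IntegrableOn (fun r => r * kernel p β r) (Ioi 0) :=
    integrableOn_mul_betaKernel hβ (one_sub_inv_toReal_pos p hp hp')
  set F := orbitIntegral α p N f
  rw [cesaroT_apply, mul_smul, ← smul_sub, ← integral_smul_const,
    ← integral_sub (integrable_smul_dilationT α p hp' hk F) (hk.smul_const F), norm_smul,
    Real.norm_of_nonneg hβ.le, ← integral_mul_const]
  gcongr
  refine norm_integral_le_of_norm_le (hk2.mul_const _) ?_
  filter_upwards [ae_restrict_mem measurableSet_Ioi] with r hr
  have hr0 : (0 : ℝ) < r := hr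
  have hk0 : 0 ≤ kernel p β r := betaKernel_nonneg β _ hr0.le
  rw [← smul_sub, norm_smul, Real.norm_of_nonneg hk0, mul_comm r, mul_assoc]
  gcongr
  exact norm_dilationT_orbitIntegral_sub_le α p hp' N f hr0.le

/-! ### Unboundedness of the orbit integrals and the lower bound for the norm -/

lemma toLp_orbitIntegral (hp' : p ≠ ∞) {N : ℝ} (hN : 0 ≤ N) (φ : SchwartzHalf α p) :
    toLp α p (orbitIntegral α p N φ) =ᵐ[halfLine]
      fun t => ∫ r in Ioc 0 N, dilation p r (toSchwartz α p φ) t := by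
  -- An orbit integral is the average with constant kernel `1` on `(0, N]`.
  have hk : IntegrableOn (fun _ : ℝ => (1 : ℝ)) (Ioc 0 N) := by simp
  have h1 := toLp_integral_smul_dilationT α p hp' hk φ
  have h2 := integral_smul_dilLp_ae_eq p hk hp'
    ((SchwartzMap.memLp (toSchwartz α p φ) p volume).restrict (Ioi 0))
  have h3 : toLp α p φ = inclusionLp α p φ := by
    rw [← toLpCLM_apply α p hp', toLpCLM_coe]
  rw [h3] at h1
  simp only [one_smul] at h1 h2
  rw [orbitIntegral, intervalIntegral.integral_of_le hN, h1]
  exact h2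

/-- The `p`-th power of the lower bound `t^{-1/p}` is `1/t`, whose integral over `(e, e^N]` is `N -
1`. -/
lemma le_norm_toLp_orbitIntegral (hp' : p ≠ ∞) {N : ℝ} (hN : 1 ≤ N) :
    N - 1 ≤ ‖toLp α p (orbitIntegral α p N ((toSchwartz α p).symm testSchwartz))‖ ^ p.toReal := by
  have hp0 : p ≠ 0 := (zero_lt_one.trans_le (Fact.out : 1 ≤ p)).ne'
  have hp1 : 0 < p.toReal := ENNReal.toReal_pos hp0 hp'
  set F := toLp α p (orbitIntegral α p N ((toSchwartz α p).symm testSchwartz)) with hF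
  have hae : F =ᵐ[halfLine] fun t => ∫ r in Ioc 0 N, dilation p r testSchwartz t :=
    toLp_orbitIntegral α p hp' (by linarith) _
  have h1 : ENNReal.ofReal (N - 1) ≤ eLpNorm F p halfLine ^ p.toReal := by
    have hle : Real.exp 1 ≤ Real.exp N := Real.exp_le_exp.2 hN
    have hI : IntegrableOn (fun t : ℝ => t⁻¹) (Ioc (Real.exp 1) (Real.exp N)) := by
      rw [← intervalIntegrable_iff_integrableOn_Ioc_of_le hle]
      refine intervalIntegral.intervalIntegrable_inv (fun t ht => ?_) continuousOn_id
      rw [uIcc_of_le hle] at ht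
      exact ((Real.exp_pos 1).trans_le ht.1).ne'
    have hint : ∫ t in Ioc (Real.exp 1) (Real.exp N), t⁻¹ = N - 1 := by
      rw [← intervalIntegral.integral_of_le hle, integral_inv_of_pos (Real.exp_pos _)
        (Real.exp_pos _), ← Real.exp_sub, Real.log_exp]
    have hpos : ∀ t ∈ Ioc (Real.exp 1) (Real.exp N), 0 < t := fun t ht =>
      (Real.exp_pos 1).trans ht.1
    rw [eLpNorm_eq_lintegral_rpow_enorm_toReal hp0 hp', ← ENNReal.rpow_mul,
      one_div_mul_cancel hp1.ne', ENNReal.rpow_one, ← hint,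
      ofReal_integral_eq_lintegral_ofReal hI]
    · calc ∫⁻ t in Ioc (Real.exp 1) (Real.exp N), ENNReal.ofReal t⁻¹
          ≤ ∫⁻ t in Ioc (Real.exp 1) (Real.exp N), ‖F t‖ₑ ^ p.toReal := by
            refine lintegral_mono_ae ?_
            have hae' := ae_restrict_of_ae_restrict_of_subset
              (show Ioc (Real.exp 1) (Real.exp N) ⊆ Ioi (0 : ℝ) from hpos) hae
            filter_upwards [hae', ae_restrict_mem measurableSet_Ioc] with t ht ht2
            have ht0 := hpos t ht2
            have l := le_norm_integral_dilation_testSchwartz p ht2.1.le ht2.2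
            rw [ht, ← ofReal_norm, ENNReal.ofReal_rpow_of_nonneg (norm_nonneg _) hp1.le]
            refine ENNReal.ofReal_le_ofReal ?_
            calc t⁻¹ = (t ^ (-(1 / p.toReal))) ^ p.toReal := by
                  rw [← Real.rpow_mul ht0.le, neg_mul, one_div_mul_cancel hp1.ne',
                    Real.rpow_neg_one]
              _ ≤ _ := by gcongr
        _ ≤ ∫⁻ t, ‖F t‖ₑ ^ p.toReal ∂halfLine :=
            lintegral_mono' (Measure.restrict_mono_set _ hpos) le_rfl
    · filter_upwards [ae_restrict_mem measurableSet_Ioc] with t ht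
      exact inv_nonneg.2 (hpos t ht).le
  have h2 := ENNReal.toReal_mono
    (ENNReal.rpow_ne_top_of_nonneg hp1.le (Lp.memLp F).2.ne) h1
  rwa [ENNReal.toReal_ofReal (by linarith), ← ENNReal.toReal_rpow, ← Lp.norm_def] at h2

lemma exists_le_norm_toLp_orbitIntegral (hp' : p ≠ ∞) (M : ℝ) :
    ∃ N, M ≤ ‖toLp α p (orbitIntegral α p N ((toSchwartz α p).symm testSchwartz))‖ := by
  have hp0 : p ≠ 0 := (zero_lt_one.trans_le (Fact.out : 1 ≤ p)).ne'
  have hp1 : 0 < p.toReal := ENNReal.toReal_pos hp0 hp'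
  have hM : 0 ≤ max M 0 := le_max_right _ _
  refine ⟨(max M 0) ^ p.toReal + 1, (le_max_left M 0).trans ?_⟩
  have h := le_norm_toLp_orbitIntegral α p hp' (N := (max M 0) ^ p.toReal + 1)
    (by linarith [Real.rpow_nonneg hM p.toReal])
  rw [add_sub_cancel_right] at h
  exact (Real.rpow_le_rpow_iff hM (norm_nonneg _) hp1).1 h

/-- If `‖C‖ < K`, then `(K - ‖C‖) ‖F_N‖ ≤ A` with `A` independent of `N`, against the unboundedness
of `F_N` in `L^p`. -/
lemma le_norm_cesaroT (hp : 1 < p) (hp' : p ≠ ∞) {β : ℝ} (hβ : 0 < β) :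
    β * ∫ r in Ioi (0 : ℝ), kernel p β r ≤ ‖cesaroT α p hp hp' hβ‖ := by
  by_contra! hlt
  set K := β * ∫ r in Ioi (0 : ℝ), kernel p β r with hK
  set C := cesaroT α p hp hp' hβ
  have hK0 : 0 ≤ K := (norm_nonneg C).trans hlt.le
  set φ := (((toSchwartz α p).symm testSchwartz : SchwartzHalf α p) : SobolevT α p)
  set A := β * ((∫ r in Ioi (0 : ℝ), r * kernel p β r) * (2 * ‖φ‖))
  -- The first term is the bound that `h4` will give for the `L^p` norm; adding `1` makes the
  -- contradiction strict.
  obtain ⟨N, hN⟩ := exists_le_norm_toLp_orbitIntegral α p hp'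
    (‖toLpCLM α p hp'‖ * (A / (K - ‖C‖)) + 1)
  set F := orbitIntegral α p N φ
  have h1 : ‖C F - K • F‖ ≤ A := norm_cesaroT_orbitIntegral_sub_le α p hp hp' hβ N φ
  have h2 : K * ‖F‖ ≤ ‖C‖ * ‖F‖ + A := by
    calc K * ‖F‖ = ‖K • F‖ := by rw [norm_smul, Real.norm_of_nonneg hK0]
      _ = ‖C F - (C F - K • F)‖ := by rw [sub_sub_cancel]
      _ ≤ ‖C F‖ + ‖C F - K • F‖ := norm_sub_le _ _
      _ ≤ _ := add_le_add (C.le_opNorm F) h1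
  have h3 : ‖F‖ ≤ A / (K - ‖C‖) := by
    rw [le_div_iff₀ (sub_pos.2 hlt)]
    linarith
  have h4 : ‖toLp α p F‖ ≤ ‖toLpCLM α p hp'‖ * (A / (K - ‖C‖)) := by
    rw [← toLpCLM_apply α p hp']
    exact ((toLpCLM α p hp').le_opNorm F).trans (by gcongr)
  linarith

end

end CesaroSobolev

end

open CesaroSobolev in
theorem mainTheorem1 (α : ℝ≥0) (p : ℝ≥0∞) [Fact (1 ≤ p)] (hp : 1 < p) (hp' : p ≠ ∞)
    (β : ℝ) (hβ : 0 < β) :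
    UniformContinuous (inclusionLp α p) ∧
    (∀ (r : ℝ) (f : SobolevT α p),
      toLp α p (dilationT α p r f) =ᵐ[halfLine] dilation p r (toLp α p f)) ∧
    ∃ C : SobolevT α p →L[ℂ] SobolevT α p,
      (∀ f : SobolevT α p,
        (∀ᵐ t ∂halfLine, IntegrableOn (fun s => (t - s) ^ (β - 1) • toLp α p f s) (Ioo 0 t)) ∧
        toLp α p (C f) =ᵐ[halfLine] cesaro β (toLp α p f)) ∧
      ‖C‖ = Real.Gamma (β + 1) * Real.Gamma (1 - 1 / p.toReal) /
        Real.Gamma (β + 1 - 1 / p.toReal) ∧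
      (∀ f : SobolevT α p,
        IntegrableOn (fun r => kernel p β r • dilationT α p r f) (Ioi 0) ∧
        C f = β • ∫ r in Ioi (0 : ℝ), kernel p β r • dilationT α p r f) ∧
      (∀ (f : SobolevT α p) (g : ℝ → ℂ), g =ᵐ[halfLine] toLp α p f →
        (∀ᵐ t ∂halfLine, IntegrableOn (fun r => kernel p β r • dilation p r g t) (Ioi 0)) ∧
        ∀ t : ℝ, 0 < t →
          cesaro β g t = β • ∫ r in Ioi (0 : ℝ), kernel p β r • dilation p r g t) := by
  have hk := integrableOn_kernel p hp hp' hβ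
  refine ⟨uniformContinuous_inclusionLp α p hp', fun r f => ?_, cesaroT α p hp hp' hβ,
    fun f => ⟨?_, toLp_cesaroT α p hp hp' hβ f⟩, ?_, fun f =>
    ⟨integrable_smul_dilationT α p hp' hk f, cesaroT_apply α p hp hp' hβ f⟩, fun f g hg =>
    ⟨ae_integrable_smul_dilation p hk ((memLp_congr_ae hg).2 (Lp.memLp _)),
      fun t ht => cesaro_eq_integral_dilation p β g ht⟩⟩
  · rw [toLp_dilationT α p hp']
    exact coeFn_dilLp p r _
  · filter_upwards [ae_integrable_smul_dilation p hk (Lp.memLp (toLp α p f)),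
      ae_restrict_mem measurableSet_Ioi] with t ht ht0
    exact (integrableOn_cesaro_iff p β _ ht0).2 ht
  · rw [← integral_kernel p hp hp' hβ]
    exact le_antisymm (norm_cesaroT_le α p hp hp' hβ) (le_norm_cesaroT α p hp hp' hβ)
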